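/- **Theorem (Operator–Holonomy Identity).** Let $d,n\ge 0$ and let $A_1,\dots,A_d:\mathbb R^d\to M_n(\mathbb C)$ be continuously differentiable. On functions $\mathbb R^d\to\mathbb C^n$ put $D_\mu=\partial_\mu+A_\mu(x)$ and, for $c\in\mathbb R^d$, $c\cdot D=\sum_\mu c_\mu D_\mu$. Let $v:[0,2\pi]\to\mathbb R^d$ be smooth with $\int_0^{2\pi}v(\theta)\,d\theta=0$, and for $x\in\mathbb R^d$ let $C_x(\theta)=x+\int_0^\theta v(\theta')\,d\theta'$ be the closed loop with base point $x$ and velocity $\dot C_x=v$. Path-ordered exponentials are limits of ordered products in which the parameter increases from left to right: for partitions $0=t_0\le t_1\le\dots\le t_N=2\pi$ with tags $\theta_k\in[t_k,t_{k+1}]$ and $\Delta_k=t_{k+1}-t_k$, $$\mathbb P\exp\int_0^{2\pi}X(\theta)\,d\theta=\lim_{\max_k\Delta_k\to0}e^{\Delta_0X(\theta_0)}\,e^{\Delta_1X(\theta_1)}\cdots e^{\Delta_{N-1}X(\theta_{N-1})}.$$ 1. For every $x\in\mathbb R^d$ the holonomy $W[C_x]=\mathbb P\exp\int_0^{2\pi}\sum_\mu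 v_\mu(\theta)A_\mu(C_x(\theta))\,d\theta\in M_n(\mathbb C)$ exists, i.e. the matrix products converge. 2. For every $c\in\mathbb R^d$ and $f\in C^1_c(\mathbb R^d;\mathbb C^n)$ there is a unique curve $u:\mathbb R\to C^1_c(\mathbb R^d;\mathbb C^n)$ with $u(0)=f$ that satisfies $u'(t)=c\cdot D\,u(t)$ for all $t$, the derivative being taken in $L^2$-norm; put $e^{c\cdot D}f=u(1)$. With these operators, for every $f\in C^1_c(\mathbb R^d;\mathbb C^n)$, $$\Big(\mathbb P\exp\int_0^{2\pi}v_\mu(\theta)D_\mu\,d\theta\;f\Big)(x)=W[C_x]\,f(x),$$ the limit of the operator products applied to $f$ being taken in $L^2(\mathbb R^d;\mathbb C^n)$. 3. Suppose moreover that the Hermitian parts of the $A_\mu$ are bounded, i.e. the entries of $A_\mu(x)+A_\mu(x)^*$ are bounded uniformly in $x$ (as for skew-Hermitian gauge fields, where they vanish). Then for every $c\in\mathbb R^d$ there is a unique strongly continuous one-parameter group $(e^{t\,c\cdot D})_{t\in\mathbb R}$ of bounded operators on the Hilbert space $\mathcal H=L^2(\mathbb R^d;\mathbb C^n)$ whose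 generator extends $c\cdot D$ on $C^1_c(\mathbb R^d;\mathbb C^n)$; the path-ordered exponential $\mathbb P\exp\int_0^{2\pi}v_\mu(\theta)D_\mu\,d\theta$ exists as a bounded operator on $\mathcal H$ in the sense of strong convergence of the operator products; and for every $\psi\in\mathcal H$ $$\Big(\mathbb P\exp\int_0^{2\pi}v_\mu(\theta)D_\mu\,d\theta\;\psi\Big)(x)=W[C_x]\,\psi(x)\qquad\text{for almost every }x.$$ That is, at every base point $x$ the operator acts by the holonomy matrix $W[C_x]$ on the $\mathbb C^n$ factor, with no translation or differentiation left in the space of functions. -/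

import Mathlib

open MeasureTheory Filter Topology Set
open scoped ContDiff Matrix

noncomputable section

namespace OperatorHolonomy

/-- Coordinate space `ℝ^d`. -/
abbrev Pos (d : ℕ) : Type := EuclideanSpace ℝ (Fin d)

/-- The space `ℂ^n` on which the group-space matrices act. -/
abbrev Col (n : ℕ) : Type := EuclideanSpace ℂ (Fin n)

/-- The Hilbert space `L²(ℝ^d; ℂ^n)`, that is `ℂ^n ⊗ L²(ℝ^d)`. -/
abbrev Hilb (d n : ℕ) : Type := Lp (Col n) 2 (volume : Measure (Pos d))

/-- A matrix-valued vector field `A_μ(x)`. -/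
abbrev GaugeField (d n : ℕ) : Type := Fin d → Pos d → Matrix (Fin n) (Fin n) ℂ

/-- A matrix acting on a vector of `ℂ^n`. -/
def act {n : ℕ} (M : Matrix (Fin n) (Fin n) ℂ) (w : Col n) : Col n :=
  WithLp.toLp 2 (M *ᵥ WithLp.ofLp w)

/-! ### The covariant derivative -/

/-- `D_μ = 1 ∂_μ + A_μ(x)`, acting on `ℂ^n`-valued functions. -/
def covDeriv {d n : ℕ} (A : GaugeField d n) (μ : Fin d) (f : Pos d → Col n) : Pos d → Col n :=
  fun x => fderiv ℝ f x (EuclideanSpace.single μ 1) + act (A μ x) (f x)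

/-- The contraction `c_μ D_μ = ∑ μ, c_μ D_μ` with a constant vector `c`. -/
def dirCovDeriv {d n : ℕ} (A : GaugeField d n) (c : Pos d) (f : Pos d → Col n) :
    Pos d → Col n :=
  fun x => ∑ μ, c μ • covDeriv A μ f x

/-- The dense domain `C¹_c(ℝ^d; ℂ^n)` on which first-order operators act classically. -/
def IsC1c {d n : ℕ} (f : Pos d → Col n) : Prop :=
  ContDiff ℝ 1 f ∧ HasCompactSupport f

/-! ### Exponentials of first-order operators -/

/-- `u t = exp (t L) f` on the domain `C¹_c`: a curve in `C¹_c` starting at `f` and solving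
`du/dt = L u`, the derivative being taken in the norm of `L²`. -/
structure IsExpOrbit {d n : ℕ} (L : (Pos d → Col n) → (Pos d → Col n)) (f : Pos d → Col n)
    (u : ℝ → Pos d → Col n) : Prop where
  init : u 0 = f
  mem : ∀ t, IsC1c (u t)
  deriv : ∀ t, Tendsto
    (fun h : ℝ => eLpNorm (fun x => h⁻¹ • (u (t + h) x - u t x) - L (u t) x) 2 volume)
    (𝓝[≠] 0) (𝓝 0)

open Classical in
/-- The operator `exp L` on the domain `C¹_c` (its value is meaningful where the orbit of the
function exists and is unique). -/
def expDom {d n : ℕ} (L : (Pos d → Col n) → (Pos d → Col n)) : Function.End (Pos d → Col n) :=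
  fun f => if h : ∃ u, IsExpOrbit L f u then h.choose 1 else 0

/-- `U t = exp (t L)` as bounded operators on the Hilbert space: a strongly continuous
one-parameter group whose infinitesimal generator extends `L` on `C¹_c`. -/
structure IsExpGroup {d n : ℕ} (L : (Pos d → Col n) → (Pos d → Col n))
    (U : ℝ → (Hilb d n →L[ℂ] Hilb d n)) : Prop where
  map_zero : U 0 = 1
  map_add : ∀ s t, U (s + t) = U s * U t
  continuous : ∀ ψ, Continuous fun t => U t ψ
  generator : ∀ f, IsC1c f → ∀ ψ χ : Hilb d n, ψ =ᵐ[volume] f → χ =ᵐ[volume] L f →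
    HasDerivAt (fun t => U t ψ) χ 0

open Classical in
/-- The bounded operator `exp L` on the Hilbert space (its value is meaningful where the group
generated by `L` exists and is unique). -/
def expHilb {d n : ℕ} (L : (Pos d → Col n) → (Pos d → Col n)) : Hilb d n →L[ℂ] Hilb d n :=
  if h : ∃ U, IsExpGroup L U then h.choose 1 else 0

/-! ### Path-ordered exponentials as limits of ordered products -/

/-- A tagged partition `0 = t_0 ≤ t_1 ≤ ... ≤ t_N = 2π` with tags `θ_k ∈ [t_k, t_{k+1}]`
(values at indices beyond `N` are irrelevant). -/
structure TaggedPartition where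
  N : ℕ
  pt : ℕ → ℝ
  tag : ℕ → ℝ
  pt_zero : pt 0 = 0
  pt_last : pt N = 2 * Real.pi
  tag_mem : ∀ k < N, tag k ∈ Icc (pt k) (pt (k + 1))

/-- The filter "mesh of the partition tends to zero". -/
def meshFilter : Filter TaggedPartition :=
  ⨅ δ ∈ Ioi (0 : ℝ), 𝓟 {P | ∀ k < P.N, P.pt (k + 1) - P.pt k < δ}

/-- The ordered product of the factors `F θ_k Δθ_k` with the parameter increasing from left to
right, `F θ_0 Δθ_0 * F θ_1 Δθ_1 * ... * F θ_{N-1} Δθ_{N-1}`. -/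
def TaggedPartition.orderedProd {M : Type*} [Monoid M] (P : TaggedPartition) (F : ℝ → ℝ → M) : M :=
  ((List.range P.N).map fun k => F (P.tag k) (P.pt (k + 1) - P.pt k)).prod

/-! ### The loop and its holonomy -/

/-- The path `C(θ) = x + ∫_0^θ v` with base point `x` and velocity `v`. -/
def path {d : ℕ} (v : ℝ → Pos d) (x : Pos d) (θ : ℝ) : Pos d :=
  x + ∫ s in (0 : ℝ)..θ, v s

/-- The factor `exp (h v_μ(θ) A_μ(C(θ)))` of the holonomy. -/
def holonomyFactor {d n : ℕ} (A : GaugeField d n) (v : ℝ → Pos d) (x : Pos d) (θ h : ℝ) :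
    Matrix (Fin n) (Fin n) ℂ :=
  NormedSpace.exp (h • ∑ μ, v θ μ • A μ (path v x θ))

/-- The Wilson-loop holonomy `P exp ∫_0^{2π} v_μ(θ) A_μ(C(θ)) dθ` along the path based at `x`. -/
def holonomy {d n : ℕ} (A : GaugeField d n) (v : ℝ → Pos d) (x : Pos d) :
    Matrix (Fin n) (Fin n) ℂ :=
  limUnder meshFilter fun P => P.orderedProd (holonomyFactor A v x)

end OperatorHolonomy

end

open OperatorHolonomy

/-!
Write `a(x)(b) = b_μ A_μ(x)` for the connection form of the gauge field. The equation
`∂_t u = c · D u` is transport along the lines of direction `c`: with `Φ(b, x)` the parallel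
transport along the segment from `x` to `x + b` (`Connection.segment`), its solution is
`u(t, x) = Φ(t c, x) f(x + t c)` (`Connection.shift`). So `exp (h v · D)` is a translation by `h v`
followed by a multiplication, and an ordered product of such operators is
`f ↦ Φ_0 Φ_1 ⋯ Φ_{N-1}(x) f(x + p_N)`, where `Φ_k` is the transport along the `k`-th side of the
polygon with base point `x` and sides `h_k v(θ_k)` (`Connection.prod_expDom_apply`). As the mesh
tends to zero the polygon converges to the path `C_x`, its last vertex `x + p_N` converges to
`x + ∫ v = x`, and the product of the transports converges to the holonomy of `C_x`, so that the
translations cancel and only multiplication by the holonomy is left.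

Three ingredients make this precise.

* The transport is continuously differentiable in `(b, x)` (`Connection.contDiff_segment`), which is
  what keeps the orbits in `C¹_c`. It is obtained by inverting `1 - K_B` on the Banach space
  `C([0, 1])`, where `K_B` is the Volterra operator `Z ↦ ∫ Z B`: the inverse depends smoothly on
  `B`, and the field along a segment is a continuously differentiable function of the segment with
  values in `C([0, 1])` (`contDiff_one_curry`).
* The factors `exp (h B(θ))` of the holonomy and the transports along the sides of the polygon both
  agree with `1 + h B(θ)` up to `o(h)`, uniformly on compact sets of base points. A discrete
  Gronwall estimate (`norm_prod_range_sub_le`) compares either product with the solution of `Y' = Y B`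
  (`Connection.eventually_norm_prod_sub_wilson_le`).
* The exponentials are unique. On `C¹_c` an orbit is paired with a time-reversed orbit of the formal
  adjoint, which is the covariant derivative of the dual connection `-a^*`; the pairing is constant
  by integration by parts (`IsExpOrbit.inner_toLp_eq`). On the Hilbert space, if `U` is a group
  whose generator extends `c · D`, then `U(-t) u(t)` is constant along every orbit `u` in `C¹_c`
  (`IsExpGroup.eq_shiftOp`).

If the Hermitian parts are bounded, the transport along a segment `b` has norm at most
`exp (κ ‖b‖)` (`norm_pexp_le`), so the ordered products are uniformly bounded on the Hilbert space
and their convergence extends from the dense domain `C¹_c` to all vectors.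
-/

noncomputable section

namespace OperatorHolonomy

/-! ### Differentiation uniform on compact sets -/

/-- A function that is continuously differentiable in a parameter is differentiable in that
parameter uniformly over compact sets of the remaining variable. -/
theorem exists_forall_norm_sub_le_of_isCompact {P X F : Type*} [NormedAddCommGroup P]
    [NormedSpace ℝ P] [TopologicalSpace X] [NormedAddCommGroup F] [NormedSpace ℝ F]
    {G : P → X → F} {G' : P → X → P →L[ℝ] F}
    (hG : ∀ p y, HasFDerivAt (fun q => G q y) (G' p y) p)
    (hG' : Continuous fun z : P × X => G' z.1 z.2) {K : Set X} (hK : IsCompact K) (p : P)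
    {ε : ℝ} (hε : 0 < ε) :
    ∃ δ > 0, ∀ q, ‖q - p‖ < δ → ∀ y ∈ K, ‖G q y - G p y - G' p y (q - p)‖ ≤ ε * ‖q - p‖ := by
  have h : ∀ᶠ q in 𝓝 p, ∀ y ∈ K, ‖G' q y - G' p y‖ < ε := by
    refine hK.eventually_forall_of_forall_eventually (P := fun q y => ‖G' q y - G' p y‖ < ε) ?_
    intro y _
    have hc : Continuous fun z : P × X => ‖G' z.1 z.2 - G' p z.2‖ :=
      (hG'.sub (hG'.comp (continuous_const.prodMk continuous_snd))).norm
    exact (hc.tendsto (p, y)).eventually_lt_const (by simpa using hε)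
  obtain ⟨δ, hδ, hball⟩ := Metric.eventually_nhds_iff_ball.1 h
  refine ⟨δ, hδ, fun q hq y hy => ?_⟩
  refine (convex_ball p δ).norm_image_sub_le_of_norm_hasFDerivWithin_le'
    (f := fun q => G q y) (f' := fun q => G' q y)
    (fun r _ => (hG r y).hasFDerivWithinAt) (fun r hr => (hball r hr y hy).le)
    (Metric.mem_ball_self hδ) ?_
  rwa [Metric.mem_ball, dist_eq_norm]

theorem hasFDerivAt_left_of_contDiff {P X F : Type*} [NormedAddCommGroup P]
    [NormedSpace ℝ P] [NormedAddCommGroup X] [NormedSpace ℝ X] [NormedAddCommGroup F]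
    [NormedSpace ℝ F] {H : P × X → F} (hH : ContDiff ℝ 1 H) (p : P) (x : X) :
    HasFDerivAt (fun q => H (q, x)) ((fderiv ℝ H (p, x)).comp (ContinuousLinearMap.inl ℝ P X)) p :=
  HasFDerivAt.comp (g := H) (f := fun q => (q, x)) p
    ((hH.differentiable one_ne_zero) (p, x)).hasFDerivAt (hasFDerivAt_prodMk_left p x)

/-- The canonical map `C(X, P →L F) → (P →L C(X, F))` exchanging the two arguments. -/
def flipContinuousMap {P X F : Type*} [NormedAddCommGroup P]
    [NormedSpace ℝ P] [TopologicalSpace X] [CompactSpace X] [NormedAddCommGroup F]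
    [NormedSpace ℝ F] : C(X, P →L[ℝ] F) →L[ℝ] P →L[ℝ] C(X, F) :=
  LinearMap.mkContinuous₂
    (LinearMap.mk₂ ℝ (fun (L : C(X, P →L[ℝ] F)) (h : P) =>
        (⟨fun x => L x h, by fun_prop⟩ : C(X, F)))
      (fun _ _ _ => by ext; simp) (fun _ _ _ => by ext; simp) (fun _ _ _ => by ext; simp)
      (fun _ _ _ => by ext; simp)) 1 (by
    intro L h
    rw [ContinuousMap.norm_le _ (by positivity)]
    intro x
    simp only [LinearMap.mk₂_apply, ContinuousMap.coe_mk, one_mul]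
    exact (L x).le_of_opNorm_le (L.norm_coe_le_norm x) h)

/-- A function that is continuously differentiable in a parameter is a continuously differentiable
function of the parameter with values in the Banach space of continuous functions of the remaining
variable. -/
theorem contDiff_one_curry {P X F : Type*} [NormedAddCommGroup P]
    [NormedSpace ℝ P] [TopologicalSpace X] [CompactSpace X] [NormedAddCommGroup F]
    [NormedSpace ℝ F] {G : C(P × X, F)} {G' : P → X → P →L[ℝ] F}
    (hG : ∀ p y, HasFDerivAt (fun q => G (q, y)) (G' p y) p)
    (hG' : Continuous fun z : P × X => G' z.1 z.2) :
    ContDiff ℝ 1 G.curry := by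
  rw [contDiff_one_iff_hasFDerivAt]
  refine ⟨fun p => flipContinuousMap ((⟨_, hG'⟩ : C(P × X, P →L[ℝ] F)).curry p), ?_, ?_⟩
  · exact flipContinuousMap.continuous.comp (ContinuousMap.continuous _)
  · intro p
    rw [hasFDerivAt_iff_isLittleO, Asymptotics.isLittleO_iff]
    intro ε hε
    obtain ⟨δ, hδ, h⟩ := exists_forall_norm_sub_le_of_isCompact (G := fun p y => G (p, y)) hG hG'
      isCompact_univ p hε
    filter_upwards [Metric.ball_mem_nhds p hδ] with q hq
    refine (ContinuousMap.norm_le _ (by positivity)).2 fun y => ?_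
    exact h q (by rwa [← dist_eq_norm]) y (mem_univ y)

/-! ### Parallel transport in a Banach algebra -/

theorem isUnit_one_sub_of_norm_pow_lt_one {R : Type*} [NormedRing R] [CompleteSpace R]
    {x : R} {k : ℕ} (hk : ‖x ^ k‖ < 1) : IsUnit (1 - x) := by
  have hu := isUnit_one_sub_of_norm_lt_one hk
  rw [← mul_neg_geom_sum] at hu
  refine ((Commute.isUnit_mul_iff ?_).1 hu).1
  exact (mul_neg_geom_sum _ _).trans (geom_sum_mul_neg _ _).symm

theorem contDiff_ringInverse_one_sub_apply {E X : Type*} [NormedAddCommGroup E] [NormedSpace ℝ E]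
    [NormedAddCommGroup X] [NormedSpace ℝ X] [CompleteSpace X] (T : E →L[ℝ] X →L[ℝ] X)
    (hT : ∀ B, IsUnit (1 - T B)) (x : X) :
    ContDiff ℝ 1 fun B => Ring.inverse (1 - T B) x := by
  rw [contDiff_iff_contDiffAt]
  intro B
  have h1 : ContDiffAt ℝ 1 (fun B => Ring.inverse (1 - T B)) B := by
    obtain ⟨u, hu⟩ := hT B
    refine ContDiffAt.comp B (g := Ring.inverse) ?_
      (contDiffAt_const.sub T.contDiff.contDiffAt)
    rw [← hu]
    exact contDiffAt_ringInverse ℝ u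
  exact h1.clm_apply contDiffAt_const

section Transport

variable {𝔸 : Type*} [NormedRing 𝔸] [NormedAlgebra ℝ 𝔸]

/-- The Volterra operator `Z ↦ (t ↦ ∫_0^t Z)` on `C([0, 1], 𝔸)`. -/
def volterra : C(unitInterval, 𝔸) →L[ℝ] C(unitInterval, 𝔸) :=
  LinearMap.mkContinuous
    { toFun := fun Z => ⟨fun t => ∫ s in (0 : ℝ)..t, Z (projIcc 0 1 zero_le_one s), by
          refine (intervalIntegral.continuous_primitive (fun a b => ?_) 0).comp
            continuous_subtype_val
          exact (Z.continuous.comp continuous_projIcc).intervalIntegrable a b⟩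
      map_add' := fun Z Z' => by
        ext t
        exact intervalIntegral.integral_add
          ((Z.continuous.comp continuous_projIcc).intervalIntegrable _ _)
          ((Z'.continuous.comp continuous_projIcc).intervalIntegrable _ _)
      map_smul' := fun c Z => by
        ext t
        exact intervalIntegral.integral_smul c _ } 1 (by
    intro Z
    rw [ContinuousMap.norm_le _ (by positivity), one_mul]
    intro t
    refine (intervalIntegral.norm_integral_le_of_norm_le_const (C := ‖Z‖)
      fun s _ => Z.norm_coe_le_norm _).trans ?_
    rw [sub_zero, abs_of_nonneg t.2.1]
    exact mul_le_of_le_one_right (norm_nonneg _) t.2.2)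

theorem volterra_apply (Z : C(unitInterval, 𝔸)) (t : unitInterval) :
    volterra Z t = ∫ s in (0 : ℝ)..t, Z (projIcc 0 1 zero_le_one s) := rfl

/-- The operator `Z ↦ (t ↦ ∫_0^t Z B)`, as a continuous linear function of `B`. -/
def volterraMul :
    C(unitInterval, 𝔸) →L[ℝ] C(unitInterval, 𝔸) →L[ℝ] C(unitInterval, 𝔸) :=
  (ContinuousLinearMap.compL ℝ C(unitInterval, 𝔸) C(unitInterval, 𝔸) C(unitInterval, 𝔸)
    volterra).comp (ContinuousLinearMap.mul ℝ C(unitInterval, 𝔸)).flip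

theorem volterraMul_apply (B Z : C(unitInterval, 𝔸)) : volterraMul B Z = volterra (Z * B) := rfl

theorem norm_volterraMul_pow_apply_le (B Z : C(unitInterval, 𝔸)) (k : ℕ) (t : unitInterval) :
    ‖(volterraMul B ^ k) Z t‖ ≤ ‖B‖ ^ k * (t : ℝ) ^ k / k.factorial * ‖Z‖ := by
  induction k generalizing t with
  | zero => simpa using Z.norm_coe_le_norm t
  | succ k ih =>
    rw [pow_succ', mul_apply_eq_comp, volterraMul_apply, volterra_apply]
    have hint : ∫ s in (0 : ℝ)..t, ‖B‖ ^ (k + 1) * s ^ k / k.factorial * ‖Z‖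
        = ‖B‖ ^ (k + 1) * (t : ℝ) ^ (k + 1) / (k + 1).factorial * ‖Z‖ := by
      rw [intervalIntegral.integral_mul_const, intervalIntegral.integral_div,
        intervalIntegral.integral_const_mul, integral_pow, Nat.factorial_succ]
      push_cast
      field_simp
      simp
    rw [← hint]
    refine intervalIntegral.norm_integral_le_of_norm_le t.2.1 (ae_of_all _ fun s hs => ?_)
      (by apply Continuous.intervalIntegrable; fun_prop)
    have hs' : s ∈ Icc (0 : ℝ) 1 := ⟨hs.1.le, hs.2.trans t.2.2⟩
    rw [projIcc_of_mem zero_le_one hs', ContinuousMap.mul_apply]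
    refine (norm_mul_le _ _).trans ((mul_le_mul (ih ⟨s, hs'⟩) (B.norm_coe_le_norm _)
      (norm_nonneg _) ?_).trans_eq ?_)
    · have := hs'.1
      positivity
    · simp only; ring

theorem eq_of_hasDerivAt_mul {B : ℝ → 𝔸} (hB : Continuous B) {y z : ℝ → 𝔸}
    (hy : ∀ t, HasDerivAt y (y t * B t) t) (hz : ∀ t, HasDerivAt z (z t * B t) t)
    (h0 : y 0 = z 0) : y = z := by
  ext t
  obtain ⟨C, hC⟩ := (isCompact_Icc (a := -|t| - 1) (b := |t| + 1)).exists_bound_of_continuousOn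
    hB.continuousOn
  have hL : ∀ s ∈ Ioo (-|t| - 1) (|t| + 1),
      LipschitzOnWith C.toNNReal (fun Y => Y * B s) univ := by
    intro s hs
    refine (LipschitzWith.of_dist_le_mul fun Y Y' => ?_).lipschitzOnWith
    rw [dist_eq_norm, ← sub_mul, dist_eq_norm, mul_comm]
    exact (norm_mul_le _ _).trans (mul_le_mul_of_nonneg_left
      ((hC s (Ioo_subset_Icc_self hs)).trans (Real.le_coe_toNNReal C)) (norm_nonneg _))
  refine ODE_solution_unique_of_mem_Ioo (t₀ := 0) (v := fun s Y => Y * B s) hL ?_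
    (fun s _ => ⟨hy s, mem_univ _⟩) (fun s _ => ⟨hz s, mem_univ _⟩) h0 ?_
  · constructor <;> linarith [abs_nonneg t]
  · constructor <;> linarith [neg_abs_le t, le_abs_self t]

variable [CompleteSpace 𝔸]

/-- Some power of the Volterra operator is a strict contraction, which makes the integral equation
`Z = 1 + ∫ Z B` uniquely solvable for every `B`. -/
theorem isUnit_one_sub_volterraMul (B : C(unitInterval, 𝔸)) : IsUnit (1 - volterraMul B) := by
  obtain ⟨k, hk⟩ := ((FloorSemiring.tendsto_pow_div_factorial_atTop ‖B‖).eventually_lt_const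
    one_pos).exists
  have hn : ‖volterraMul B ^ k‖ < 1 := by
    refine lt_of_le_of_lt (ContinuousLinearMap.opNorm_le_bound _ (by positivity) fun Z => ?_) hk
    rw [ContinuousMap.norm_le _ (by positivity)]
    intro t
    refine (norm_volterraMul_pow_apply_le B Z k t).trans ?_
    gcongr
    exact mul_le_of_le_one_right (by positivity) (pow_le_one₀ t.2.1 t.2.2)
  exact isUnit_one_sub_of_norm_pow_lt_one (R := C(unitInterval, 𝔸) →L[ℝ] C(unitInterval, 𝔸)) hn

/-- The solution `Z` of `Z' = Z B`, `Z(0) = 1` on `[0, 1]`, obtained by inverting `1 - K_B` for the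
integral operator `K_B Z = ∫ Z B`. -/
def transport (B : C(unitInterval, 𝔸)) : C(unitInterval, 𝔸) :=
  Ring.inverse (1 - volterraMul B) 1

theorem transport_apply (B : C(unitInterval, 𝔸)) (t : unitInterval) :
    transport B t = 1 + ∫ s in (0 : ℝ)..t, transport B (projIcc 0 1 zero_le_one s) *
      B (projIcc 0 1 zero_le_one s) := by
  have h := congrArg (fun L => (L 1 : C(unitInterval, 𝔸)) t)
    (Ring.mul_inverse_cancel _ (isUnit_one_sub_volterraMul B))
  simp only [mul_apply_eq_comp, sub_apply, ContinuousMap.sub_apply,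
    one_apply_eq_self, ContinuousMap.one_apply, volterraMul_apply] at h
  rw [sub_eq_iff_eq_add] at h
  exact h

theorem contDiff_transport :
    ContDiff ℝ 1 (transport : C(unitInterval, 𝔸) → C(unitInterval, 𝔸)) := by
  have h := contDiff_ringInverse_one_sub_apply (E := C(unitInterval, 𝔸)) (X := C(unitInterval, 𝔸))
    volterraMul isUnit_one_sub_volterraMul 1
  exact h

/-- The path-ordered exponential `P exp ∫_0^t B`, that is the solution of `Y' = Y B`, `Y(0) = 1`
(the parameter increases from left to right), for `t` of either sign; `[0, t]` is rescaled to the unit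
interval. -/
def pexp (B : C(ℝ, 𝔸)) (t : ℝ) : 𝔸 :=
  transport ⟨fun s : unitInterval => t • B (t * s), by fun_prop⟩ 1

theorem transport_unique {B Z : C(unitInterval, 𝔸)}
    (h : ∀ t, Z t = 1 + volterra (Z * B) t) : Z = transport B := by
  have h1 : (1 - volterraMul B) Z = 1 := by
    ext t
    simp [volterraMul_apply, h t]
  have h2 := congrArg (fun L => L Z) (Ring.inverse_mul_cancel _ (isUnit_one_sub_volterraMul B))
  simp only [mul_apply_eq_comp, h1, one_apply_eq_self] at h2
  exact h2.symm

/-- The transport along an initial segment `[0, r]` of the unit interval is the transport along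
the rescaled field. -/
theorem transport_rescale (B : C(ℝ, 𝔸)) (T : ℝ) (r : unitInterval) :
    transport ⟨fun s : unitInterval => T • B (T * s), by fun_prop⟩ r = pexp B (r * T) := by
  set C : C(unitInterval, 𝔸) := ⟨fun s : unitInterval => T • B (T * s), by fun_prop⟩ with hC
  have key : (⟨fun s => transport C (r * s), by fun_prop⟩ : C(unitInterval, 𝔸)) =
      transport ⟨fun s : unitInterval => (r * T : ℝ) • B (r * T * s), by fun_prop⟩ := by
    apply transport_unique
    intro t
    simp only [ContinuousMap.coe_mk]
    rw [transport_apply, volterra_apply, add_right_inj]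
    have hsub := intervalIntegral.smul_integral_comp_mul_left (a := 0) (b := (t : ℝ))
      (fun s => transport C (projIcc 0 1 zero_le_one s) * C (projIcc 0 1 zero_le_one s)) (r : ℝ)
    rw [mul_zero] at hsub
    rw [Set.Icc.coe_mul, ← hsub, ← intervalIntegral.integral_smul]
    refine intervalIntegral.integral_congr fun s hs => ?_
    rw [uIcc_of_le t.2.1] at hs
    have hs' : s ∈ Icc (0 : ℝ) 1 := ⟨hs.1, hs.2.trans t.2.2⟩
    have hrs : (r : ℝ) * s ∈ Icc (0 : ℝ) 1 :=
      ⟨mul_nonneg r.2.1 hs'.1, mul_le_one₀ r.2.2 hs'.1 hs'.2⟩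
    simp only [ContinuousMap.mul_apply, projIcc_of_mem zero_le_one hs',
      projIcc_of_mem zero_le_one hrs, ContinuousMap.coe_mk, hC, mul_smul, mul_smul_comm]
    congr 4
    ring
  have h := congrArg (fun Z : C(unitInterval, 𝔸) => Z 1) key
  simpa [pexp] using h

theorem pexp_zero (B : C(ℝ, 𝔸)) : pexp B 0 = 1 := by
  have h := transport_rescale B 1 0
  rw [transport_apply] at h
  simpa using h.symm

theorem continuous_pexp_uncurry {X : Type*} [TopologicalSpace X] {B : X → C(ℝ, 𝔸)}
    (hB : Continuous fun z : X × ℝ => B z.1 z.2) :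
    Continuous fun z : X × ℝ => pexp (B z.1) z.2 := by
  let G : C((X × ℝ) × unitInterval, 𝔸) :=
    ⟨fun z => z.1.2 • B z.1.1 (z.1.2 * z.2), by
      refine (continuous_snd.comp continuous_fst).smul (hB.comp (f := fun z : (X × ℝ) ×
        unitInterval => (z.1.1, z.1.2 * (z.2 : ℝ))) (by fun_prop))⟩
  exact (continuous_eval_const (F := C(unitInterval, 𝔸)) 1).comp
    (contDiff_transport.continuous.comp G.curry.continuous)

theorem continuous_pexp (B : C(ℝ, 𝔸)) : Continuous (pexp B) := by
  have h := continuous_pexp_uncurry (X := Unit) (B := fun _ => B)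
    (B.continuous.comp continuous_snd)
  have h' := h.comp (f := fun t : ℝ => ((), t)) (Continuous.prodMk_right ())
  exact h'

theorem pexp_eq_integral (B : C(ℝ, 𝔸)) (t : ℝ) :
    pexp B t = 1 + ∫ s in (0 : ℝ)..t, pexp B s * B s := by
  have hsub := intervalIntegral.smul_integral_comp_mul_right (a := 0) (b := 1)
      (fun s => pexp B s * B s) t
  rw [zero_mul, one_mul] at hsub
  rw [← hsub, ← intervalIntegral.integral_smul]
  conv_lhs => rw [pexp, transport_apply]
  rw [add_right_inj]
  refine intervalIntegral.integral_congr fun s hs => ?_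
  rw [uIcc_of_le (by simp)] at hs
  have hs' : s ∈ Icc (0 : ℝ) 1 := by simpa using hs
  simp only [transport_rescale, projIcc_of_mem zero_le_one hs', ContinuousMap.coe_mk,
    mul_smul_comm, mul_comm t s]

theorem hasDerivAt_pexp (B : C(ℝ, 𝔸)) (t : ℝ) : HasDerivAt (pexp B) (pexp B t * B t) t := by
  have hc : Continuous fun s => pexp B s * B s := (continuous_pexp B).mul B.continuous
  have h := (intervalIntegral.integral_hasDerivAt_right (hc.intervalIntegrable 0 t)
    (hc.stronglyMeasurableAtFilter _ _) hc.continuousAt).const_add 1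
  exact h.congr_of_eventuallyEq (Eventually.of_forall fun s => pexp_eq_integral B s)

/-- Path-ordered exponentials compose along concatenated intervals. -/
theorem pexp_add (B B' : C(ℝ, 𝔸)) (s : ℝ) (h : ∀ t, B' t = B (s + t)) (t : ℝ) :
    pexp B (s + t) = pexp B s * pexp B' t := by
  refine congrFun (eq_of_hasDerivAt_mul (B := B') B'.continuous
    (y := fun t => pexp B (s + t)) (z := fun t => pexp B s * pexp B' t) ?_ ?_ ?_) t
  · intro t
    rw [h]
    exact (hasDerivAt_pexp B (s + t)).comp_const_add s t
  · intro t
    rw [mul_assoc]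
    exact (hasDerivAt_pexp B' t).const_mul _
  · simp [pexp_zero]

end Transport

variable {d n : ℕ}

/-! ### Connection forms and parallel transport along segments -/

/-- The algebra of operators on `ℂ^n`. -/
abbrev End (n : ℕ) : Type := Col n →L[ℂ] Col n

/-- A continuously differentiable connection form: the value at `x` in the direction `b` is the
operator `b_μ A_μ(x)`. -/
structure Connection (d n : ℕ) where
  /-- The value of the form at a point. -/
  form : Pos d → Pos d →L[ℝ] End n
  contDiff : ContDiff ℝ 1 form

/-- `c · D = ∂_c + a(c)` for a connection form `a`. -/
def Connection.covD (a : Connection d n) (c : Pos d) (f : Pos d → Col n) : Pos d → Col n :=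
  fun x => fderiv ℝ f x c + a.form x c (f x)

/-- The component of the connection along the line `s ↦ x + s c`. -/
def Connection.along (a : Connection d n) (c x : Pos d) : C(ℝ, End n) :=
  ⟨fun s => a.form (x + s • c) c,
    (a.contDiff.continuous.comp (by fun_prop)).clm_apply continuous_const⟩

/-- Parallel transport along the segment from `x` to `x + b`. -/
def Connection.segment (a : Connection d n) (b x : Pos d) : End n := pexp (a.along b x) 1

theorem Connection.segment_smul (a : Connection d n) (c x : Pos d) (t : ℝ) :
    a.segment (t • c) x = pexp (a.along c x) t := by
  unfold segment pexp
  congr 2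
  ext1 s
  simp [along, smul_smul, mul_comm]

@[simp] theorem Connection.segment_zero (a : Connection d n) (x : Pos d) : a.segment 0 x = 1 := by
  have h := a.segment_smul 0 x 0
  rwa [zero_smul, pexp_zero] at h

theorem Connection.segment_add (a : Connection d n) (c x : Pos d) (s t : ℝ) :
    a.segment ((s + t) • c) x = a.segment (s • c) x * a.segment (t • c) (x + s • c) := by
  rw [segment_smul, segment_smul, segment_smul]
  refine pexp_add _ _ s (fun t => ?_) t
  simp [along, add_smul, add_assoc]

/-- Joint continuous differentiability in the base point and the direction: the field along the
segment is a continuously differentiable function of both with values in `C([0, 1])`, and the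
transport is a smooth function on that space. -/
theorem Connection.contDiff_segment (a : Connection d n) :
    ContDiff ℝ 1 fun z : Pos d × Pos d => a.segment z.1 z.2 := by
  have hH : ContDiff ℝ 1 fun w : (Pos d × Pos d) × ℝ => a.form (w.1.2 + w.2 • w.1.1) w.1.1 :=
    (a.contDiff.comp (by fun_prop)).clm_apply (by fun_prop)
  let G : C((Pos d × Pos d) × unitInterval, End n) :=
    ⟨fun w => a.form (w.1.2 + (w.2 : ℝ) • w.1.1) w.1.1,
      hH.continuous.comp (f := fun w : (Pos d × Pos d) × unitInterval => (w.1, (w.2 : ℝ)))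
        (by fun_prop)⟩
  have hG : ContDiff ℝ 1 G.curry := by
    refine contDiff_one_curry (G' := fun p s => (fderiv ℝ (fun w : (Pos d × Pos d) × ℝ =>
      a.form (w.1.2 + w.2 • w.1.1) w.1.1) (p, (s : ℝ))).comp (ContinuousLinearMap.inl ℝ _ _))
      (fun p s => ?_) ?_
    · exact hasFDerivAt_left_of_contDiff hH p (s : ℝ)
    · exact ((hH.continuous_fderiv one_ne_zero).comp
        (f := fun w : (Pos d × Pos d) × unitInterval => (w.1, (w.2 : ℝ)))
        (by fun_prop)).clm_comp continuous_const
  have heq : (fun z : Pos d × Pos d => a.segment z.1 z.2) =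
      fun z => ContinuousMap.evalCLM ℝ (1 : unitInterval) (transport (G.curry z)) := by
    ext1 z
    have h : (⟨fun s : unitInterval => (1 : ℝ) • a.along z.1 z.2 (1 * (s : ℝ)), by fun_prop⟩ :
        C(unitInterval, End n)) = G.curry z := by
      ext1 s
      simp [along, G]
    rw [← h]
    rfl
  rw [heq]
  exact (ContinuousMap.evalCLM ℝ (1 : unitInterval)).contDiff.comp (contDiff_transport.comp hG)

theorem Connection.hasDerivAt_segment (a : Connection d n) (c x : Pos d) :
    HasDerivAt (fun t : ℝ => a.segment (t • c) x) (a.form x c) 0 := by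
  have h := hasDerivAt_pexp (a.along c x) 0
  rw [pexp_zero, one_mul] at h
  simpa [segment_smul, along] using h

/-- To first order, transport along a short segment `b` is `1 + a(b)`, uniformly over base points
in a compact set. -/
theorem Connection.norm_segment_sub_le (a : Connection d n) {K : Set (Pos d)} (hK : IsCompact K)
    {ε : ℝ} (hε : 0 < ε) :
    ∃ δ > 0, ∀ b, ‖b‖ < δ → ∀ x ∈ K, ‖a.segment b x - 1 - a.form x b‖ ≤ ε * ‖b‖ := by
  have hc := a.contDiff_segment
  have hd : ∀ p x, HasFDerivAt (fun q => a.segment q x)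
      ((fderiv ℝ (fun z : Pos d × Pos d => a.segment z.1 z.2) (p, x)).comp
        (ContinuousLinearMap.inl ℝ _ _)) p := fun p x =>
    hasFDerivAt_left_of_contDiff hc p x
  obtain ⟨δ, hδ, h⟩ := exists_forall_norm_sub_le_of_isCompact (G := a.segment) hd
    ((hc.continuous_fderiv one_ne_zero).clm_comp continuous_const) hK 0 hε
  refine ⟨δ, hδ, fun b hb x hx => ?_⟩
  have h1 := h b (by simpa using hb) x hx
  have h2 : ((fderiv ℝ (fun z : Pos d × Pos d => a.segment z.1 z.2) (0, x)).comp
        (ContinuousLinearMap.inl ℝ _ _)) b = a.form x b := by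
    have h3 := hd ((0 : ℝ) • b) x
    have h4 := h3.comp_hasDerivAt (0 : ℝ) ((hasDerivAt_id (0 : ℝ)).smul_const b)
    simp only [zero_smul, one_smul] at h4
    exact h4.unique (a.hasDerivAt_segment b x)
  simpa only [sub_zero, segment_zero, h2] using h1

/-! ### The exponential of the covariant derivative on `C¹_c` -/

/-- The operator `exp (c · D)`: translation by `c` followed by parallel transport back along the
segment. -/
def Connection.shift (a : Connection d n) (c : Pos d) (f : Pos d → Col n) : Pos d → Col n :=
  fun x => a.segment c x (f (x + c))

@[simp] theorem Connection.shift_zero (a : Connection d n) (f : Pos d → Col n) :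
    a.shift 0 f = f := by
  ext1 x
  simp [shift]

theorem Connection.shift_add (a : Connection d n) (c : Pos d) (s t : ℝ) (f : Pos d → Col n) :
    a.shift ((s + t) • c) f = a.shift (s • c) (a.shift (t • c) f) := by
  ext1 x
  simp only [shift]
  rw [segment_add, mul_apply_eq_comp, add_smul, add_assoc]

theorem contDiff_end_apply {E : Type*} [NormedAddCommGroup E] [NormedSpace ℝ E]
    {M : E → End n} {w : E → Col n} (hM : ContDiff ℝ 1 M) (hw : ContDiff ℝ 1 w) :
    ContDiff ℝ 1 fun x => M x (w x) :=
  ((ContinuousLinearMap.restrictScalarsL ℂ (Col n) (Col n) ℝ ℝ).contDiff.comp hM).clm_apply hw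

theorem hasDerivAt_end_apply {M : ℝ → End n} {M' : End n} {w : ℝ → Col n} {w' : Col n} {t : ℝ}
    (hM : HasDerivAt M M' t) (hw : HasDerivAt w w' t) :
    HasDerivAt (fun t => M t (w t)) (M' (w t) + M t w') t :=
  ((ContinuousLinearMap.restrictScalarsL ℂ (Col n) (Col n) ℝ ℝ).hasFDerivAt.comp_hasDerivAt t
    hM).clm_apply hw

theorem IsC1c.zero_of_norm_lt {f : Pos d → Col n} (hf : IsC1c f) :
    ∃ R, ∀ x, R < ‖x‖ → f x = 0 ∧ fderiv ℝ f x = 0 := by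
  obtain ⟨R, hR⟩ := (Metric.isBounded_iff_subset_closedBall 0).1 hf.2.isCompact.isBounded
  refine ⟨R, fun x hx => ?_⟩
  have hx' : x ∉ tsupport f := fun h => by
    have := hR h
    rw [mem_closedBall_zero_iff] at this
    linarith
  exact ⟨image_eq_zero_of_notMem_tsupport hx', Function.notMem_support.1
    fun h => hx' (support_fderiv_subset ℝ h)⟩

theorem hasCompactSupport_of_norm {f : Pos d → Col n} {R : ℝ} (h : ∀ x, R < ‖x‖ → f x = 0) :
    HasCompactSupport f :=
  HasCompactSupport.of_support_subset_isCompact (isCompact_closedBall 0 R) fun x hx => by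
    rw [mem_closedBall_zero_iff]
    by_contra hlt
    exact hx (h x (not_le.1 hlt))

theorem IsC1c.shift (a : Connection d n) (c : Pos d) {f : Pos d → Col n} (hf : IsC1c f) :
    IsC1c (a.shift c f) := by
  have h1 : ContDiff ℝ 1 fun x => a.segment c x :=
    a.contDiff_segment.comp (f := fun x => (c, x)) (by fun_prop)
  have h2 : ContDiff ℝ 1 fun x => f (x + c) := hf.1.comp (by fun_prop)
  refine ⟨contDiff_end_apply h1 h2, ?_⟩
  obtain ⟨R, hR⟩ := hf.zero_of_norm_lt
  refine hasCompactSupport_of_norm (R := R + ‖c‖) fun x hx => ?_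
  rw [Connection.shift, (hR _ _).1, map_zero]
  have := norm_sub_le (x + c) c
  rw [add_sub_cancel_right] at this
  linarith

theorem IsC1c.continuous_covD (a : Connection d n) (c : Pos d) {f : Pos d → Col n}
    (hf : IsC1c f) : Continuous (a.covD c f) :=
  ((hf.1.continuous_fderiv one_ne_zero).clm_apply continuous_const).add
    (((a.contDiff.continuous).clm_apply continuous_const).clm_apply hf.1.continuous)

theorem IsC1c.hasCompactSupport_covD (a : Connection d n) (c : Pos d) {f : Pos d → Col n}
    (hf : IsC1c f) : HasCompactSupport (a.covD c f) := by
  obtain ⟨R, hR⟩ := hf.zero_of_norm_lt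
  refine hasCompactSupport_of_norm (R := R) fun x hx => ?_
  simp [Connection.covD, hR x hx]

theorem IsC1c.memLp {f : Pos d → Col n} (hf : IsC1c f) : MemLp f 2 volume :=
  hf.1.continuous.memLp_of_hasCompactSupport hf.2

theorem IsC1c.memLp_covD (a : Connection d n) (c : Pos d) {f : Pos d → Col n} (hf : IsC1c f) :
    MemLp (a.covD c f) 2 volume :=
  (hf.continuous_covD a c).memLp_of_hasCompactSupport (hf.hasCompactSupport_covD a c)

/-- Uniform convergence to zero with supports in a fixed compact set implies convergence in
`L²`. -/
theorem tendsto_eLpNorm_of_forall_norm_le {ι : Type*} {l : Filter ι} {g : ι → Pos d → Col n}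
    {K : Set (Pos d)} (hK : IsCompact K)
    (h : ∀ ε > 0, ∀ᶠ i in l, (∀ x ∈ K, ‖g i x‖ ≤ ε) ∧ ∀ x ∉ K, g i x = 0) :
    Tendsto (fun i => eLpNorm (g i) 2 volume) l (𝓝 0) := by
  rw [ENNReal.tendsto_nhds_zero]
  intro η hη
  set C : ENNReal := volume K ^ (2 : ENNReal).toReal⁻¹ with hC
  have hCtop : C ≠ ⊤ := ENNReal.rpow_ne_top_of_nonneg (by simp) hK.measure_lt_top.ne
  have hlim : Tendsto (fun ε : ℝ => C * ENNReal.ofReal ε) (𝓝[>] 0) (𝓝 0) := by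
    have h1 : Tendsto (fun ε : ℝ => ENNReal.ofReal ε) (𝓝[>] 0) (𝓝 0) := by
      simpa using (ENNReal.tendsto_ofReal (tendsto_id (α := ℝ) (x := 𝓝 0))).mono_left
        (nhdsWithin_le_nhds (s := Ioi 0))
    simpa using ENNReal.Tendsto.const_mul h1 (Or.inr hCtop)
  obtain ⟨ε, hε, hpos⟩ :=
    ((ENNReal.tendsto_nhds_zero.1 hlim η hη).and self_mem_nhdsWithin).exists
  filter_upwards [h ε hpos] with i hi
  have hsupp : Function.support (g i) ⊆ K := fun x hx => by
    by_contra hxK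
    exact hx (hi.2 x hxK)
  rw [← eLpNorm_restrict_eq_of_support_subset hsupp]
  refine (eLpNorm_le_of_ae_bound (C := ε) ?_).trans ?_
  · exact (ae_restrict_iff' hK.measurableSet).2 (ae_of_all _ hi.1)
  · rwa [Measure.restrict_apply_univ]

/-- The generator of translation with parallel transport is the covariant derivative. -/
theorem Connection.tendsto_shift (a : Connection d n) (c : Pos d) {f : Pos d → Col n}
    (hf : IsC1c f) :
    Tendsto (fun h : ℝ => eLpNorm (fun x => h⁻¹ • (a.shift (h • c) f x - f x) - a.covD c f x)
      2 volume) (𝓝[≠] 0) (𝓝 0) := by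
  obtain ⟨R, hR⟩ := hf.zero_of_norm_lt
  have hG : ContDiff ℝ 1 fun z : ℝ × Pos d => a.shift (z.1 • c) f z.2 :=
    contDiff_end_apply (a.contDiff_segment.comp
      (f := fun z : ℝ × Pos d => (z.1 • c, z.2)) (by fun_prop)) (hf.1.comp (by fun_prop))
  have hd : ∀ p x, HasFDerivAt (fun q : ℝ => a.shift (q • c) f x)
      ((fderiv ℝ (fun z : ℝ × Pos d => a.shift (z.1 • c) f z.2) (p, x)).comp
        (ContinuousLinearMap.inl ℝ _ _)) p := fun p x =>
    hasFDerivAt_left_of_contDiff hG p x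
  refine tendsto_eLpNorm_of_forall_norm_le (isCompact_closedBall 0 (R + ‖c‖)) fun ε hε => ?_
  obtain ⟨δ, hδ, h⟩ := exists_forall_norm_sub_le_of_isCompact
    (G := fun q : ℝ => a.shift (q • c) f) hd
    ((hG.continuous_fderiv one_ne_zero).clm_comp continuous_const)
    (isCompact_closedBall 0 (R + ‖c‖)) 0 hε
  have hball : ∀ᶠ h : ℝ in 𝓝[≠] 0, |h| < min δ 1 := by
    have := Metric.ball_mem_nhds (0 : ℝ) (lt_min hδ one_pos)
    filter_upwards [mem_nhdsWithin_of_mem_nhds this] with h hh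
    simpa using hh
  filter_upwards [hball, self_mem_nhdsWithin] with t ht ht0
  have ht0' : t ≠ 0 := ht0
  constructor
  · intro x hx
    have h1 := h t (by simpa using ht.trans_le (min_le_left _ _)) x hx
    have h2 : ((fderiv ℝ (fun z : ℝ × Pos d => a.shift (z.1 • c) f z.2) (0, x)).comp
        (ContinuousLinearMap.inl ℝ _ _)) t = t • a.covD c f x := by
      have h3 := (hd 0 x).hasDerivAt
      have h4 : HasDerivAt (fun q : ℝ => a.shift (q • c) f x) (a.covD c f x) 0 := by
        have h5 : HasDerivAt (fun q : ℝ => f (x + q • c)) (fderiv ℝ f x c) 0 := by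
          have h6 : HasFDerivAt f (fderiv ℝ f x) (x + (0 : ℝ) • c) := by
            rw [zero_smul, add_zero]
            exact ((hf.1.differentiable one_ne_zero) x).hasFDerivAt
          have h7 := h6.comp_hasDerivAt (0 : ℝ)
            (((hasDerivAt_id (0 : ℝ)).smul_const c).const_add x)
          rw [one_smul] at h7
          exact h7
        have h8 := hasDerivAt_end_apply (a.hasDerivAt_segment c x) h5
        simp only [zero_smul, add_zero, segment_zero, one_apply_eq_self] at h8
        rw [covD, add_comm]
        exact h8
      rw [← h3.unique h4, ← map_smul]
      simp
    simp only [sub_zero, zero_smul, shift_zero] at h1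
    rw [h2] at h1
    have h5 : t⁻¹ • (a.shift (t • c) f x - f x) - a.covD c f x =
        t⁻¹ • (a.shift (t • c) f x - f x - t • a.covD c f x) := by
      rw [smul_sub t⁻¹ (a.shift (t • c) f x - f x), inv_smul_smul₀ ht0']
    rw [h5, norm_smul, norm_inv]
    exact (inv_mul_le_iff₀ (norm_pos_iff.2 ht0')).2 (h1.trans_eq (mul_comm _ _))
  · intro x hx
    rw [mem_closedBall_zero_iff, not_le] at hx
    have h0 := hR x (by linarith [norm_nonneg c])
    have h1 : f (x + t • c) = 0 := by
      refine (hR _ ?_).1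
      have h2 := norm_sub_le (x + t • c) (t • c)
      rw [add_sub_cancel_right, norm_smul] at h2
      have h3 : ‖t‖ * ‖c‖ ≤ 1 * ‖c‖ := by
        gcongr
        exact (ht.trans_le (min_le_right _ _)).le
      linarith
    simp [shift, covD, h0, h1]

/-- Existence of the orbits of `exp (t c · D)` on `C¹_c`. -/
theorem Connection.isExpOrbit_shift (a : Connection d n) (c : Pos d) {f : Pos d → Col n}
    (hf : IsC1c f) : IsExpOrbit (a.covD c) f fun t => a.shift (t • c) f where
  init := by simp
  mem t := hf.shift a _
  deriv t := by
    simpa only [add_comm t, shift_add] using a.tendsto_shift c (hf.shift a (t • c))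

/-! ### Uniqueness of orbits by duality -/

/-- The dual connection `-a^*`. -/
def Connection.dual (a : Connection d n) : Connection d n where
  form x := -((starL' ℝ : End n ≃L[ℝ] End n) : End n →L[ℝ] End n).comp (a.form x)
  contDiff := (contDiff_const.clm_comp a.contDiff).neg

theorem Connection.dual_form (a : Connection d n) (x b : Pos d) :
    a.dual.form x b = -ContinuousLinearMap.adjoint (a.form x b) := rfl

/-- The derivative in `L²` of a curve of square-integrable functions, as a derivative in the
Hilbert space. -/
theorem hasDerivAt_toLp {u : ℝ → Pos d → Col n} (hu : ∀ t, MemLp (u t) 2 volume)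
    {w : Pos d → Col n} (hw : MemLp w 2 volume) {t : ℝ}
    (h : Tendsto (fun h : ℝ => eLpNorm (fun x => h⁻¹ • (u (t + h) x - u t x) - w x) 2 volume)
      (𝓝[≠] 0) (𝓝 0)) :
    HasDerivAt (fun s => (hu s).toLp (u s)) (hw.toLp w) t := by
  rw [hasDerivAt_iff_tendsto_slope_zero, tendsto_iff_norm_sub_tendsto_zero]
  have h1 := (ENNReal.tendsto_toReal ENNReal.zero_ne_top).comp h
  rw [ENNReal.toReal_zero] at h1
  refine h1.congr fun s => ?_
  rw [← MemLp.toLp_sub, ← MemLp.toLp_const_smul, ← MemLp.toLp_sub, Lp.norm_toLp]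
  rfl

/-- The orbit of a function as a differentiable curve in the Hilbert space. -/
theorem IsExpOrbit.hasDerivAt {a : Connection d n} {c : Pos d} {f : Pos d → Col n}
    {u : ℝ → Pos d → Col n} (hu : IsExpOrbit (a.covD c) f u) (t : ℝ) :
    HasDerivAt (fun s => (hu.mem s).memLp.toLp (u s)) (((hu.mem t).memLp_covD a c).toLp _) t :=
  hasDerivAt_toLp (fun s => (hu.mem s).memLp) _ (hu.deriv t)

theorem inner_toLp {f g : Pos d → Col n} (hf : MemLp f 2 volume) (hg : MemLp g 2 volume) :
    inner ℂ (hf.toLp f) (hg.toLp g) = ∫ x, inner ℂ (f x) (g x) := by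
  rw [L2.inner_def]
  refine integral_congr_ae ?_
  filter_upwards [hf.coeFn_toLp, hg.coeFn_toLp] with x h1 h2
  rw [h1, h2]

/-- The formal adjoint of `c · D` for a connection is `-c · D` for the dual connection. -/
theorem Connection.integral_inner_covD (a : Connection d n) (c : Pos d) {f g : Pos d → Col n}
    (hf : IsC1c f) (hg : IsC1c g) :
    ∫ x, inner ℂ (g x) (a.covD c f x) = ∫ x, inner ℂ (a.dual.covD (-c) g x) (f x) := by
  have hfc := hf.1.continuous
  have hgc := hg.1.continuous
  have hfd : Continuous fun x => fderiv ℝ f x c :=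
    (hf.1.continuous_fderiv one_ne_zero).clm_apply continuous_const
  have hgd : Continuous fun x => fderiv ℝ g x c :=
    (hg.1.continuous_fderiv one_ne_zero).clm_apply continuous_const
  have haf : Continuous fun x => a.form x c (f x) :=
    ((a.contDiff.continuous).clm_apply continuous_const).clm_apply hfc
  obtain ⟨R, hR⟩ := hg.zero_of_norm_lt
  have hint : ∀ {φ : Pos d → ℂ}, Continuous φ → (∀ x, R < ‖x‖ → φ x = 0) → Integrable φ := by
    intro φ hφ h0
    refine hφ.integrable_of_hasCompactSupport (HasCompactSupport.of_support_subset_isCompact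
      (isCompact_closedBall 0 R) fun x hx => ?_)
    rw [mem_closedBall_zero_iff]
    by_contra hlt
    exact hx (h0 x (not_le.1 hlt))
  have i1 : Integrable fun x => inner ℂ (g x) (fderiv ℝ f x c) :=
    hint (hgc.inner hfd) fun x hx => by simp [hR x hx]
  have i2 : Integrable fun x => inner ℂ (fderiv ℝ g x c) (f x) :=
    hint (hgd.inner hfc) fun x hx => by simp [hR x hx]
  have i3 : Integrable fun x => inner ℂ (g x) (f x) :=
    hint (hgc.inner hfc) fun x hx => by simp [hR x hx]
  have i4 : Integrable fun x => inner ℂ (g x) (a.form x c (f x)) :=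
    hint (hgc.inner haf) fun x hx => by simp [hR x hx]
  have hB := isBoundedBilinearMap_inner (𝕜 := ℂ) (E := Col n)
  have hparts := integral_bilinear_hasLineDerivAt_right_eq_neg_left_of_integrable
    (B := hB.toContinuousLinearMap) (v := c) (f := g) (g := f)
    (f' := fun x => fderiv ℝ g x c) (g' := fun x => fderiv ℝ f x c) i2 i1 i3
    (fun x _ => ((hg.1.differentiable one_ne_zero) x).hasFDerivAt.hasLineDerivAt c)
    (fun x _ => ((hf.1.differentiable one_ne_zero) x).hasFDerivAt.hasLineDerivAt c)
  have hparts' : ∫ x, inner ℂ (g x) (fderiv ℝ f x c) = -∫ x, inner ℂ (fderiv ℝ g x c) (f x) :=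
    hparts
  have e1 : (fun x => inner ℂ (g x) (a.covD c f x)) =
      fun x => inner ℂ (g x) (fderiv ℝ f x c) + inner ℂ (g x) (a.form x c (f x)) := by
    ext1 x
    rw [covD, inner_add_right]
  have e2 : (fun x => inner ℂ (a.dual.covD (-c) g x) (f x)) =
      fun x => -inner ℂ (fderiv ℝ g x c) (f x) + inner ℂ (g x) (a.form x c (f x)) := by
    ext1 x
    rw [covD, inner_add_left, map_neg, map_neg, dual_form, neg_neg, inner_neg_left,
      ContinuousLinearMap.adjoint_inner_left]
  have i5 : Integrable fun x => -inner ℂ (fderiv ℝ g x c) (f x) := i2.neg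
  rw [e1, e2, integral_add i1 i4, integral_add i5 i4, integral_neg, hparts']

/-- Pairing an orbit of `c · D` with a time-reversed orbit of the formal adjoint gives a constant,
so the orbit at time `τ` is determined, tested against any function of the domain. -/
theorem IsExpOrbit.inner_toLp_eq {a : Connection d n} {c : Pos d} {f : Pos d → Col n}
    {u : ℝ → Pos d → Col n} (hu : IsExpOrbit (a.covD c) f u) {g : Pos d → Col n} (hg : IsC1c g)
    (hf : IsC1c f) (τ : ℝ) :
    inner ℂ (hg.memLp.toLp g) ((hu.mem τ).memLp.toLp (u τ)) =
      inner ℂ (((hg.shift a.dual (τ • -c)).memLp).toLp _) (hf.memLp.toLp f) := by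
  have hw := a.dual.isExpOrbit_shift (-c) hg
  have hconst : ∀ s t, inner ℂ ((hw.mem (τ - s)).memLp.toLp _) ((hu.mem s).memLp.toLp (u s)) =
      inner ℂ ((hw.mem (τ - t)).memLp.toLp _) ((hu.mem t).memLp.toLp (u t)) := by
    have hder : ∀ t, HasDerivAt (fun t => inner ℂ ((hw.mem (τ - t)).memLp.toLp _)
        ((hu.mem t).memLp.toLp (u t))) 0 t := by
      intro t
      have h1 := (hw.hasDerivAt (τ - t)).scomp t ((hasDerivAt_id t).const_sub τ)
      have h2 := h1.inner ℂ (hu.hasDerivAt t)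
      refine h2.congr_deriv ?_
      rw [neg_one_smul, inner_neg_left, inner_toLp, Function.comp_apply, inner_toLp,
        a.integral_inner_covD c (hu.mem t) (hw.mem (τ - t)), add_neg_cancel]
    exact is_const_of_deriv_eq_zero (fun t => (hder t).differentiableAt) fun t => (hder t).deriv
  have h := hconst τ 0
  have e1 : (hw.mem (τ - τ)).memLp.toLp _ = hg.memLp.toLp g := by
    congr 1
    simp
  have e2 : (hu.mem 0).memLp.toLp _ = hf.memLp.toLp f := by
    congr 1
    exact hu.init
  have e3 : (hw.mem (τ - 0)).memLp.toLp _ = ((hg.shift a.dual (τ • -c)).memLp).toLp _ := by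
    congr 1
    simp
  rw [e1, e2, e3] at h
  exact h

theorem IsExpOrbit.eq_shift {a : Connection d n} {c : Pos d} {f : Pos d → Col n}
    (hf : IsC1c f) {u : ℝ → Pos d → Col n} (hu : IsExpOrbit (a.covD c) f u) :
    u = fun t => a.shift (t • c) f := by
  funext τ
  have hs := a.isExpOrbit_shift c hf
  -- the difference of two orbits lies in the domain, so it may be tested against itself
  have hgC : IsC1c (u τ - a.shift (τ • c) f) :=
    ⟨(hu.mem τ).1.sub (hs.mem τ).1, (hu.mem τ).2.sub (hs.mem τ).2⟩
  have h1 := (hu.inner_toLp_eq hgC hf τ).trans (hs.inner_toLp_eq hgC hf τ).symm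
  rw [← sub_eq_zero, ← inner_sub_right, ← MemLp.toLp_sub, inner_self_eq_zero] at h1
  have h2 := hgC.memLp.coeFn_toLp.symm
  rw [h1] at h2
  have h3 := (hgC.1.continuous.ae_eq_iff_eq volume continuous_zero).1
    (h2.trans (Lp.coeFn_zero _ _ _))
  exact sub_eq_zero.1 h3

theorem Connection.existsUnique_isExpOrbit (a : Connection d n) (c : Pos d) {f : Pos d → Col n}
    (hf : IsC1c f) : ∃! u, IsExpOrbit (a.covD c) f u :=
  ⟨_, a.isExpOrbit_shift c hf, fun _ hu => hu.eq_shift hf⟩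

theorem Connection.expDom_covD (a : Connection d n) (c : Pos d) {f : Pos d → Col n}
    (hf : IsC1c f) : expDom (a.covD c) f = a.shift c f := by
  have h : ∃ u, IsExpOrbit (a.covD c) f u := ⟨_, a.isExpOrbit_shift c hf⟩
  rw [expDom, dif_pos h, h.choose_spec.eq_shift hf]
  simp only [one_smul]

/-! ### Tagged partitions -/

theorem hasBasis_meshFilter : meshFilter.HasBasis (fun δ : ℝ => δ ∈ Ioi (0 : ℝ))
    fun δ => {P | ∀ k < P.N, P.pt (k + 1) - P.pt k < δ} := by
  refine hasBasis_biInf_principal (fun δ hδ δ' hδ' => ⟨min δ δ', mem_Ioi.2 (lt_min hδ hδ'), ?_, ?_⟩)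
    ⟨1, mem_Ioi.2 one_pos⟩
  · exact fun P hP k hk => (hP k hk).trans_le (min_le_left _ _)
  · exact fun P hP k hk => (hP k hk).trans_le (min_le_right _ _)

theorem eventually_mesh_lt {δ : ℝ} (hδ : 0 < δ) :
    ∀ᶠ P : TaggedPartition in meshFilter, ∀ k < P.N, P.pt (k + 1) - P.pt k < δ :=
  hasBasis_meshFilter.mem_of_mem hδ

/-- Equidistant partitions have arbitrarily small mesh. -/
instance neBot_meshFilter : meshFilter.NeBot := by
  refine hasBasis_meshFilter.neBot_iff.2 fun {δ} hδ => ?_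
  obtain ⟨N, hN⟩ := exists_nat_gt (2 * Real.pi / δ)
  have hN0 : (0 : ℝ) < N := lt_of_le_of_lt (div_nonneg Real.two_pi_pos.le (le_of_lt hδ)) hN
  have hstep : ∀ k : ℕ, ((k + 1 : ℕ) : ℝ) * (2 * Real.pi / N) - k * (2 * Real.pi / N) =
      2 * Real.pi / N := fun k => by
    push_cast
    ring
  refine ⟨⟨N, fun k => k * (2 * Real.pi / N), fun k => k * (2 * Real.pi / N), by simp,
    by field_simp, fun k _ => ⟨le_rfl, ?_⟩⟩, fun k _ => ?_⟩
  · rw [← sub_nonneg, hstep]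
    positivity
  · rw [hstep]
    exact (div_lt_comm₀ hN0 hδ).2 hN

namespace TaggedPartition

variable (P : TaggedPartition)

/-- The length of the `k`-th interval. -/
def step (k : ℕ) : ℝ := P.pt (k + 1) - P.pt k

theorem step_nonneg {k : ℕ} (hk : k < P.N) : 0 ≤ P.step k :=
  sub_nonneg.2 ((P.tag_mem k hk).1.trans (P.tag_mem k hk).2)

theorem pt_le_pt {j k : ℕ} (hjk : j ≤ k) (hk : k ≤ P.N) : P.pt j ≤ P.pt k := by
  induction k, hjk using Nat.le_induction with
  | base => exact le_rfl
  | succ k _ ih => exact (ih (by omega)).trans (sub_nonneg.1 (P.step_nonneg (by omega)))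

theorem pt_mem {k : ℕ} (hk : k ≤ P.N) : P.pt k ∈ Icc 0 (2 * Real.pi) :=
  ⟨P.pt_zero ▸ P.pt_le_pt k.zero_le hk, P.pt_last ▸ P.pt_le_pt hk le_rfl⟩

theorem tag_mem_Icc {k : ℕ} (hk : k < P.N) : P.tag k ∈ Icc 0 (2 * Real.pi) :=
  ⟨(P.pt_mem hk.le).1.trans (P.tag_mem k hk).1, (P.tag_mem k hk).2.trans (P.pt_mem hk).2⟩

theorem sum_step (k : ℕ) : ∑ j ∈ Finset.range k, P.step j = P.pt k := by
  simp only [step, Finset.sum_range_sub, P.pt_zero, sub_zero]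

theorem orderedProd_eq {M : Type*} [Monoid M] (F : ℝ → ℝ → M) :
    P.orderedProd F = ((List.range P.N).map fun k => F (P.tag k) (P.step k)).prod := rfl

theorem orderedProd_congr {M : Type*} [Monoid M] {F G : ℝ → ℝ → M}
    (h : ∀ θ ∈ Icc 0 (2 * Real.pi), ∀ t, F θ t = G θ t) : P.orderedProd F = P.orderedProd G := by
  rw [orderedProd_eq, orderedProd_eq]
  congr 1
  refine List.map_congr_left fun k hk => ?_
  exact h _ (P.tag_mem_Icc (List.mem_range.1 hk)) _

/-- The `k`-th vertex, relative to the base point, of the polygon that approximates the path with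
velocity `v`. -/
def vertex (v : ℝ → Pos d) (k : ℕ) : Pos d := ∑ j ∈ Finset.range k, P.step j • v (P.tag j)

theorem vertex_succ (v : ℝ → Pos d) (k : ℕ) :
    P.vertex v (k + 1) = P.vertex v k + P.step k • v (P.tag k) :=
  Finset.sum_range_succ _ _

end TaggedPartition

theorem prod_map_range_succ {M : Type*} [Monoid M] (F : ℕ → M) (k : ℕ) :
    ((List.range (k + 1)).map F).prod = ((List.range k).map F).prod * F k := by
  simp [List.range_succ]

/-! ### Convergence of ordered products -/

/-- Discrete Gronwall estimate: factors that agree with `1 + h_k B_k` up to `ε h_k` have a product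
close to any sequence that is advanced by the same factors up to the same error. -/
theorem norm_prod_range_sub_le {𝔸 : Type*} [NormedRing 𝔸] [NormedAlgebra ℝ 𝔸]
    {F B Y : ℕ → 𝔸} {h : ℕ → ℝ} {N : ℕ} {M R ε : ℝ} (hh : ∀ k < N, 0 ≤ h k)
    (hε : 0 ≤ ε) (hε1 : ε ≤ 1) (hM : 0 ≤ M) (hR : 0 ≤ R)
    (hF : ∀ k < N, ‖F k - 1 - h k • B k‖ ≤ ε * h k)
    (hY : ∀ k < N, ‖Y (k + 1) - Y k - h k • (Y k * B k)‖ ≤ ε * h k)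
    (hB : ∀ k < N, ‖B k‖ ≤ M) (hYR : ∀ k < N, ‖Y k‖ ≤ R) (hY0 : Y 0 = 1) {k : ℕ} (hk : k ≤ N) :
    ‖((List.range k).map F).prod - Y k‖ ≤ ε * (1 + R) * (∑ j ∈ Finset.range k, h j) *
      Real.exp ((M + 1) * ∑ j ∈ Finset.range k, h j) := by
  induction k with
  | zero => simp [hY0]
  | succ k ih =>
    have hkN : k < N := hk
    have ih := ih hkN.le
    have hk0 := hh k hkN
    rw [prod_map_range_succ, Finset.sum_range_succ]
    set Q := ((List.range k).map F).prod
    set S := ∑ j ∈ Finset.range k, h j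
    have hS : 0 ≤ S := Finset.sum_nonneg fun j hj =>
      hh j ((Finset.mem_range.1 hj).trans hkN)
    have hF1 : ‖F k - 1‖ ≤ (M + 1) * h k := by
      have h1 := norm_add_le (F k - 1 - h k • B k) (h k • B k)
      rw [sub_add_cancel, norm_smul, Real.norm_of_nonneg hk0] at h1
      have h2 : h k * ‖B k‖ ≤ h k * M := by gcongr; exact hB k hkN
      have h3 : ε * h k ≤ 1 * h k := by gcongr
      linarith [hF k hkN]
    have hsplit : Q * F k - Y (k + 1) = (Q - Y k) + (Q - Y k) * (F k - 1) +
        Y k * (F k - 1 - h k • B k) - (Y (k + 1) - Y k - h k • (Y k * B k)) := by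
      rw [mul_sub (Y k), mul_smul_comm]
      noncomm_ring
    have e1 : ‖(Q - Y k) * (F k - 1)‖ ≤ ‖Q - Y k‖ * ((M + 1) * h k) :=
      (norm_mul_le _ _).trans (by gcongr)
    have e2 : ‖Y k * (F k - 1 - h k • B k)‖ ≤ R * (ε * h k) :=
      (norm_mul_le _ _).trans (mul_le_mul (hYR k hkN) (hF k hkN) (norm_nonneg _) hR)
    have e3 : ‖Q * F k - Y (k + 1)‖ ≤ ‖Q - Y k‖ * (1 + (M + 1) * h k) + ε * (1 + R) * h k := by
      rw [hsplit]
      refine (norm_sub_le _ _).trans ?_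
      refine (add_le_add_left (norm_add_le _ _) _).trans ?_
      refine (add_le_add_left (add_le_add_left (norm_add_le _ _) _) _).trans ?_
      linarith [hY k hkN]
    have e4 : 1 + (M + 1) * h k ≤ Real.exp ((M + 1) * h k) := by
      linarith [Real.add_one_le_exp ((M + 1) * h k)]
    have e5 : 1 ≤ Real.exp ((M + 1) * (S + h k)) := Real.one_le_exp (by positivity)
    calc ‖Q * F k - Y (k + 1)‖
        ≤ ‖Q - Y k‖ * (1 + (M + 1) * h k) + ε * (1 + R) * h k := e3
      _ ≤ (ε * (1 + R) * S * Real.exp ((M + 1) * S)) * Real.exp ((M + 1) * h k) +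
          ε * (1 + R) * h k * Real.exp ((M + 1) * (S + h k)) := by
        refine add_le_add (mul_le_mul ih e4 (by positivity) (by positivity)) ?_
        exact le_mul_of_one_le_right (by positivity) e5
      _ = ε * (1 + R) * (S + h k) * Real.exp ((M + 1) * (S + h k)) := by
        rw [mul_add (M + 1), Real.exp_add]
        ring

/-- The component of the connection along the path with velocity `v` based at `x`. -/
def Connection.alongPath (a : Connection d n) (v : C(ℝ, Pos d)) (x : Pos d) : C(ℝ, End n) :=
  ⟨fun θ => a.form (path v x θ) (v θ), (a.contDiff.continuous.comp (continuous_const.add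
    (intervalIntegral.continuous_primitive (fun _ _ => v.continuous.intervalIntegrable _ _)
      0))).clm_apply v.continuous⟩

theorem Connection.alongPath_apply (a : Connection d n) (v : C(ℝ, Pos d)) (x : Pos d) (θ : ℝ) :
    a.alongPath v x θ = a.form (path v x θ) (v θ) := rfl

theorem continuous_path (v : C(ℝ, Pos d)) :
    Continuous fun z : Pos d × ℝ => path v z.1 z.2 :=
  continuous_fst.add ((intervalIntegral.continuous_primitive
    (fun _ _ => v.continuous.intervalIntegrable _ _) 0).comp continuous_snd)

theorem Connection.continuous_alongPath (a : Connection d n) (v : C(ℝ, Pos d)) :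
    Continuous fun z : Pos d × ℝ => a.alongPath v z.1 z.2 :=
  (a.contDiff.continuous.comp (continuous_path v)).clm_apply (v.continuous.comp continuous_snd)

/-- The holonomy along the path with velocity `v` based at `x`. -/
def Connection.wilson (a : Connection d n) (v : C(ℝ, Pos d)) (x : Pos d) : End n :=
  pexp (a.alongPath v x) (2 * Real.pi)

theorem Connection.continuous_wilson (a : Connection d n) (v : C(ℝ, Pos d)) :
    Continuous (a.wilson v) :=
  (continuous_pexp_uncurry (a.continuous_alongPath v)).comp
    (f := fun x => (x, 2 * Real.pi)) (by fun_prop)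

/-- Ordered products whose factors agree with `1 + h B` to first order in the step `h`, uniformly
over a compact set of base points, converge to the holonomy, uniformly over that set. -/
theorem Connection.eventually_norm_prod_sub_wilson_le (a : Connection d n) (v : C(ℝ, Pos d))
    {K : Set (Pos d)} (hK : IsCompact K) {F : TaggedPartition → Pos d → ℕ → End n}
    (hF : ∀ ε > 0, ∀ᶠ P in meshFilter, ∀ x ∈ K, ∀ k < P.N,
      ‖F P x k - 1 - P.step k • a.alongPath v x (P.tag k)‖ ≤ ε * P.step k)
    {ε : ℝ} (hε : 0 < ε) :
    ∀ᶠ P in meshFilter, ∀ x ∈ K, ‖((List.range P.N).map (F P x)).prod - a.wilson v x‖ ≤ ε := by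
  have hcB := a.continuous_alongPath v
  have hcY := continuous_pexp_uncurry hcB
  set J := Icc 0 (2 * Real.pi) with hJ
  have hJc : IsCompact J := isCompact_Icc
  obtain ⟨M, hM⟩ := (hK.prod hJc).exists_bound_of_continuousOn hcB.continuousOn
  obtain ⟨R, hR⟩ := (hK.prod hJc).exists_bound_of_continuousOn hcY.continuousOn
  -- `c` is the constant in the discrete Gronwall estimate for a total length of `2π`
  set c := (1 + |R|) * (2 * Real.pi) * Real.exp ((|M| + 1) * (2 * Real.pi)) with hc
  have hcpos : 0 < c := by have := Real.two_pi_pos; positivity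
  set η := min 1 (ε / c) with hη
  have hηpos : 0 < η := lt_min one_pos (div_pos hε hcpos)
  have hg : Continuous fun z : Pos d × ℝ × ℝ =>
      pexp (a.alongPath v z.1) z.2.1 * a.alongPath v z.1 z.2.2 :=
    (hcY.comp (f := fun z : Pos d × ℝ × ℝ => (z.1, z.2.1)) (by fun_prop)).mul
      (hcB.comp (f := fun z : Pos d × ℝ × ℝ => (z.1, z.2.2)) (by fun_prop))
  obtain ⟨δ, hδ, hunif⟩ := Metric.uniformContinuousOn_iff.1
    ((hK.prod (hJc.prod hJc)).uniformContinuousOn_of_continuous hg.continuousOn) η hηpos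
  filter_upwards [hF η hηpos, eventually_mesh_lt hδ] with P hP hmesh x hx
  have hY : ∀ k < P.N, ‖pexp (a.alongPath v x) (P.pt (k + 1)) - pexp (a.alongPath v x) (P.pt k) -
      P.step k • (pexp (a.alongPath v x) (P.pt k) * a.alongPath v x (P.tag k))‖ ≤
        η * P.step k := by
    intro k hk
    have htag := P.tag_mem k hk
    have hle := htag.1.trans htag.2
    have hcont : Continuous fun s => pexp (a.alongPath v x) s * a.alongPath v x s :=
      (continuous_pexp _).mul (a.alongPath v x).continuous
    have hint := intervalIntegral.integral_eq_sub_of_hasDerivAt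
      (fun s _ => hasDerivAt_pexp (a.alongPath v x) s)
      (hcont.intervalIntegrable (P.pt k) (P.pt (k + 1)))
    have hconst := intervalIntegral.integral_const (a := P.pt k) (b := P.pt (k + 1))
      (pexp (a.alongPath v x) (P.pt k) * a.alongPath v x (P.tag k))
    -- by the differential equation, the error is the integral over the `k`-th interval of the
    -- oscillation of `Y B`
    rw [← hint, TaggedPartition.step, ← hconst, ← intervalIntegral.integral_sub
      (hcont.intervalIntegrable _ _) intervalIntegrable_const]
    refine (intervalIntegral.norm_integral_le_of_norm_le_const (C := η) fun s hs => ?_).trans_eq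
      (by rw [abs_of_nonneg (sub_nonneg.2 hle)])
    rw [uIoc_of_le hle] at hs
    have hsJ : s ∈ J := ⟨(P.pt_mem hk.le).1.trans hs.1.le, hs.2.trans (P.pt_mem hk).2⟩
    have hm := hmesh k hk
    have h1 := hunif (x, s, s) ⟨hx, hsJ, hsJ⟩ (x, P.pt k, P.tag k)
      ⟨hx, P.pt_mem hk.le, P.tag_mem_Icc hk⟩ (by
        simp only [Prod.dist_eq, dist_self, Real.dist_eq]
        refine max_lt hδ (max_lt ?_ ?_) <;> rw [abs_lt] <;> constructor <;>
          linarith [hs.1, hs.2, htag.1, htag.2])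
    rw [dist_eq_norm] at h1
    exact h1.le
  have hmain := norm_prod_range_sub_le (F := F P x) (B := fun k => a.alongPath v x (P.tag k))
    (Y := fun k => pexp (a.alongPath v x) (P.pt k)) (h := P.step) (N := P.N) (M := |M|) (R := |R|)
    (ε := η) (fun k hk => P.step_nonneg hk) hηpos.le (min_le_left _ _) (abs_nonneg _)
    (abs_nonneg _) (hP x hx) hY
    (fun k hk => (hM (x, P.tag k) ⟨hx, P.tag_mem_Icc hk⟩).trans (le_abs_self M))
    (fun k hk => (hR (x, P.pt k) ⟨hx, P.pt_mem hk.le⟩).trans (le_abs_self R))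
    (by simp only [P.pt_zero, pexp_zero]) le_rfl
  simp only [P.sum_step, P.pt_last] at hmain
  refine hmain.trans ?_
  calc η * (1 + |R|) * (2 * Real.pi) * Real.exp ((|M| + 1) * (2 * Real.pi)) = η * c := by
        rw [hc]; ring
    _ ≤ ε / c * c := by gcongr; exact min_le_right _ _
    _ = ε := div_mul_cancel₀ _ hcpos.ne'

/-- The vertices of the polygon converge to the points of the path. -/
theorem eventually_norm_vertex_sub_le (v : C(ℝ, Pos d)) {ε : ℝ} (hε : 0 < ε) :
    ∀ᶠ P : TaggedPartition in meshFilter, ∀ k ≤ P.N,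
      ‖P.vertex v k - ∫ s in (0 : ℝ)..P.pt k, v s‖ ≤ ε := by
  obtain ⟨δ, hδ, hunif⟩ := Metric.uniformContinuousOn_iff.1
    ((isCompact_Icc (a := 0) (b := 2 * Real.pi)).uniformContinuousOn_of_continuous
      v.continuous.continuousOn) (ε / (2 * Real.pi)) (div_pos hε Real.two_pi_pos)
  filter_upwards [eventually_mesh_lt hδ] with P hmesh k hk
  have key : ‖P.vertex v k - ∫ s in (0 : ℝ)..P.pt k, v s‖ ≤ ε / (2 * Real.pi) * P.pt k := by
    induction k with
    | zero => simp [TaggedPartition.vertex, P.pt_zero]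
    | succ k ih =>
      have hkN : k < P.N := hk
      have htag := P.tag_mem k hkN
      have hle := htag.1.trans htag.2
      have hii : ∀ s t, IntervalIntegrable v volume s t := fun s t =>
        v.continuous.intervalIntegrable s t
      have hstep : ‖P.step k • v (P.tag k) - ∫ s in P.pt k..P.pt (k + 1), v s‖ ≤
          ε / (2 * Real.pi) * P.step k := by
        rw [TaggedPartition.step, ← intervalIntegral.integral_const,
          ← intervalIntegral.integral_sub intervalIntegrable_const (hii _ _)]
        refine (intervalIntegral.norm_integral_le_of_norm_le_const (C := ε / (2 * Real.pi))
          fun s hs => ?_).trans_eq (by rw [abs_of_nonneg (sub_nonneg.2 hle)])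
        rw [uIoc_of_le hle] at hs
        rw [← dist_eq_norm]
        have hm := hmesh k hkN
        refine (hunif _ (P.tag_mem_Icc hkN) s ⟨(P.pt_mem hkN.le).1.trans hs.1.le,
          hs.2.trans (P.pt_mem hk).2⟩ ?_).le
        rw [Real.dist_eq, abs_lt]
        constructor <;> linarith [hs.1, hs.2, htag.1, htag.2]
      rw [P.vertex_succ, ← intervalIntegral.integral_add_adjacent_intervals (hii 0 (P.pt k))
        (hii _ _), add_sub_add_comm]
      refine (norm_add_le _ _).trans ((add_le_add (ih hkN.le) hstep).trans_eq ?_)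
      rw [TaggedPartition.step]
      ring
  refine key.trans ?_
  calc ε / (2 * Real.pi) * P.pt k ≤ ε / (2 * Real.pi) * (2 * Real.pi) := by
        have := Real.two_pi_pos
        gcongr
        exact (P.pt_mem hk).2
    _ = ε := div_mul_cancel₀ _ Real.two_pi_pos.ne'

/-- The exponential factors of the definition of the holonomy. -/
theorem Connection.eventually_norm_prod_exp_sub_wilson_le (a : Connection d n) (v : C(ℝ, Pos d))
    {K : Set (Pos d)} (hK : IsCompact K) {ε : ℝ} (hε : 0 < ε) :
    ∀ᶠ P : TaggedPartition in meshFilter, ∀ x ∈ K,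
      ‖P.orderedProd (fun θ h => NormedSpace.exp (h • a.alongPath v x θ)) - a.wilson v x‖ ≤ ε := by
  refine a.eventually_norm_prod_sub_wilson_le v hK (F := fun P x k =>
    NormedSpace.exp (P.step k • a.alongPath v x (P.tag k))) (fun η hη => ?_) hε
  have hKJ := hK.prod (isCompact_Icc (a := 0) (b := 2 * Real.pi))
  obtain ⟨M, hM⟩ := hKJ.exists_bound_of_continuousOn (a.continuous_alongPath v).continuousOn
  have hexp := (hasFDerivAt_exp_zero (𝕂 := ℝ) (𝔸 := End n)).isLittleO
  rw [Asymptotics.isLittleO_iff] at hexp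
  obtain ⟨δ, hδ, hball⟩ := Metric.eventually_nhds_iff_ball.1
    (hexp (c := η / (|M| + 1)) (by positivity))
  filter_upwards [eventually_mesh_lt (div_pos hδ (by positivity : 0 < |M| + 1))] with P hP x hx k hk
  have hk0 := P.step_nonneg hk
  have hb : ‖P.step k • a.alongPath v x (P.tag k)‖ ≤ (|M| + 1) * P.step k := by
    rw [norm_smul, Real.norm_of_nonneg hk0, mul_comm]
    gcongr
    have := hM (x, P.tag k) ⟨hx, P.tag_mem_Icc hk⟩
    simp only at this
    linarith [le_abs_self M]
  have h1 := hball (P.step k • a.alongPath v x (P.tag k)) (by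
    rw [mem_ball_zero_iff]
    refine hb.trans_lt ?_
    rw [mul_comm]
    exact (lt_div_iff₀ (by positivity)).1 (hP k hk))
  simp only [NormedSpace.exp_zero, sub_zero, one_apply_eq_self] at h1
  refine h1.trans ?_
  calc η / (|M| + 1) * ‖P.step k • a.alongPath v x (P.tag k)‖
      ≤ η / (|M| + 1) * ((|M| + 1) * P.step k) := by gcongr
    _ = η * P.step k := by field_simp

open scoped Pointwise in
/-- The factors that arise from the operators `exp (h v · D)`: transport along the sides of the
polygon instead of the path. -/
theorem Connection.eventually_norm_prod_segment_sub_wilson_le (a : Connection d n)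
    (v : C(ℝ, Pos d)) {K : Set (Pos d)} (hK : IsCompact K) {ε : ℝ} (hε : 0 < ε) :
    ∀ᶠ P : TaggedPartition in meshFilter, ∀ x ∈ K,
      ‖((List.range P.N).map fun k =>
        a.segment (P.step k • v (P.tag k)) (x + P.vertex v k)).prod - a.wilson v x‖ ≤ ε := by
  refine a.eventually_norm_prod_sub_wilson_le v hK (F := fun P x k =>
    a.segment (P.step k • v (P.tag k)) (x + P.vertex v k)) (fun η hη => ?_) hε
  have hpi := Real.two_pi_pos
  obtain ⟨V₀, hV₀⟩ := (isCompact_Icc (a := 0) (b := 2 * Real.pi)).exists_bound_of_continuousOn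
    v.continuous.continuousOn
  set V := |V₀| + 1 with hVdef
  have hVpos : 0 < V := by positivity
  have hV : ∀ θ ∈ Icc 0 (2 * Real.pi), ‖v θ‖ ≤ V := fun θ hθ => by
    linarith [hV₀ θ hθ, le_abs_self V₀]
  set K' := K + Metric.closedBall (0 : Pos d) (V * (2 * Real.pi) + 1) with hK'def
  have hK' : IsCompact K' := hK.add (isCompact_closedBall _ _)
  have hη' : 0 < η / (2 * V) := by positivity
  obtain ⟨δ₁, hδ₁, hseg⟩ := a.norm_segment_sub_le hK' hη'
  obtain ⟨δ₂, hδ₂, hunif⟩ := Metric.uniformContinuousOn_iff.1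
    (hK'.uniformContinuousOn_of_continuous a.contDiff.continuous.continuousOn) _ hη'
  have hprim : ∀ s ∈ Icc 0 (2 * Real.pi), ∀ t ∈ Icc 0 (2 * Real.pi), s ≤ t →
      ‖∫ r in s..t, v r‖ ≤ V * (t - s) := fun s hs t ht hst => by
    refine (intervalIntegral.norm_integral_le_of_norm_le_const (C := V) fun r hr => ?_).trans_eq
      (by rw [abs_of_nonneg (sub_nonneg.2 hst)])
    rw [uIoc_of_le hst] at hr
    exact hV r ⟨hs.1.trans hr.1.le, hr.2.trans ht.2⟩
  have h0 : (0 : ℝ) ∈ Icc 0 (2 * Real.pi) := ⟨le_rfl, hpi.le⟩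
  filter_upwards [eventually_mesh_lt (div_pos hδ₁ hVpos),
    eventually_mesh_lt (div_pos (half_pos hδ₂) hVpos),
    eventually_norm_vertex_sub_le v (lt_min one_pos (half_pos (half_pos hδ₂)))]
    with P hm1 hm2 hvert x hx k hk
  have hk0 := P.step_nonneg hk
  have htag := P.tag_mem k hk
  have htJ := P.tag_mem_Icc hk
  have hpJ := P.pt_mem hk.le
  have hbnd : ∀ t ∈ Icc 0 (2 * Real.pi), ‖∫ r in (0 : ℝ)..t, v r‖ ≤ V * (2 * Real.pi) :=
    fun t ht => (hprim 0 h0 t ht ht.1).trans (by gcongr; linarith [ht.2])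
  have hy : x + P.vertex v k ∈ K' := by
    refine Set.add_mem_add hx ?_
    rw [mem_closedBall_zero_iff]
    have h1 := norm_add_le (P.vertex v k - ∫ s in (0 : ℝ)..P.pt k, v s)
      (∫ s in (0 : ℝ)..P.pt k, v s)
    rw [sub_add_cancel] at h1
    linarith [(hvert k hk.le).trans (min_le_left _ _), hbnd _ hpJ]
  have hz : path v x (P.tag k) ∈ K' := by
    refine Set.add_mem_add hx ?_
    rw [mem_closedBall_zero_iff]
    linarith [hbnd _ htJ]
  have hdist : dist (x + P.vertex v k) (path v x (P.tag k)) < δ₂ := by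
    rw [dist_eq_norm, path, add_sub_add_left_eq_sub,
      ← intervalIntegral.integral_add_adjacent_intervals
        (v.continuous.intervalIntegrable 0 (P.pt k)) (v.continuous.intervalIntegrable _ _),
      ← sub_sub]
    refine (norm_sub_le _ _).trans_lt ?_
    have h1 := hprim _ hpJ _ htJ htag.1
    have h2 : V * (P.tag k - P.pt k) ≤ V * P.step k := by
      gcongr
      rw [TaggedPartition.step]
      linarith [htag.2]
    have h3 := (lt_div_iff₀ hVpos).1 (hm2 k hk)
    have h4 := (hvert k hk.le).trans (min_le_right _ _)
    rw [TaggedPartition.step, mul_comm] at h2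
    linarith
  have hb : ‖P.step k • v (P.tag k)‖ ≤ P.step k * V := by
    rw [norm_smul, Real.norm_of_nonneg hk0]
    gcongr
    exact hV _ htJ
  have e1 := hseg (P.step k • v (P.tag k)) (hb.trans_lt ((lt_div_iff₀ hVpos).1 (hm1 k hk))) _ hy
  have e2 := hunif _ hy _ hz hdist
  rw [dist_eq_norm] at e2
  -- compare first with the connection at the vertex, then with the connection on the path
  have e3 : a.segment (P.step k • v (P.tag k)) (x + P.vertex v k) - 1 -
      P.step k • a.alongPath v x (P.tag k) =
      (a.segment (P.step k • v (P.tag k)) (x + P.vertex v k) - 1 -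
        a.form (x + P.vertex v k) (P.step k • v (P.tag k))) +
      (a.form (x + P.vertex v k) - a.form (path v x (P.tag k))) (P.step k • v (P.tag k)) := by
    rw [sub_apply, map_smul (a.form (path v x (P.tag k)))]
    simp only [alongPath]
    abel
  rw [e3]
  refine (norm_add_le _ _).trans ?_
  have e4 := (a.form (x + P.vertex v k) - a.form (path v x (P.tag k))).le_of_opNorm_le_of_le
    e2.le hb
  have e5 : η / (2 * V) * ‖P.step k • v (P.tag k)‖ ≤ η / (2 * V) * (P.step k * V) := by gcongr
  calc _ ≤ η / (2 * V) * (P.step k * V) + η / (2 * V) * (P.step k * V) :=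
        add_le_add (e1.trans e5) e4
    _ = η * P.step k := by field_simp; ring

/-! ### The operator-holonomy identity on `C¹_c` -/

/-- A product of exponentials `exp (h_k v_k · D)` transports along the sides of a polygon and
translates by its last vertex. -/
theorem Connection.prod_expDom_apply (a : Connection d n) (v : ℝ → Pos d) (P : TaggedPartition)
    (k : ℕ) {f : Pos d → Col n} (hf : IsC1c f) (x : Pos d) :
    ((List.range k).map fun j => expDom (a.covD (P.step j • v (P.tag j)))).prod f x =
      ((List.range k).map fun j =>
        a.segment (P.step j • v (P.tag j)) (x + P.vertex v j)).prod (f (x + P.vertex v k)) := by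
  induction k generalizing f with
  | zero =>
    simp only [List.range_zero, List.map_nil, List.prod_nil, TaggedPartition.vertex,
      Finset.sum_range_zero, add_zero, one_apply_eq_self]
    rfl
  | succ k ih =>
    rw [prod_map_range_succ, prod_map_range_succ, mul_apply_eq_comp, P.vertex_succ]
    change ((List.range k).map fun j => expDom (a.covD (P.step j • v (P.tag j)))).prod
      (expDom (a.covD (P.step k • v (P.tag k))) f) x = _
    rw [a.expDom_covD _ hf, ih (hf.shift a _), shift, add_assoc]

/-- The polygon closes up in the limit and the products converge uniformly on compact sets, so only
the holonomy is left. -/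
theorem Connection.tendsto_orderedProd_expDom (a : Connection d n) (v : C(ℝ, Pos d))
    (hv : ∫ θ in (0 : ℝ)..(2 * Real.pi), v θ = 0) {f : Pos d → Col n} (hf : IsC1c f) :
    Tendsto (fun P : TaggedPartition => eLpNorm
      (fun x => P.orderedProd (fun θ h => expDom (a.covD (h • v θ))) f x
        - a.wilson v x (f x)) 2 volume) meshFilter (𝓝 0) := by
  obtain ⟨R, hR⟩ := hf.zero_of_norm_lt
  have hK := isCompact_closedBall (0 : Pos d) (R + 1)
  obtain ⟨C, hC⟩ := hf.1.continuous.bounded_above_of_compact_support hf.2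
  obtain ⟨M, hM⟩ := hK.exists_bound_of_continuousOn (a.continuous_wilson v).continuousOn
  have hunif := Metric.uniformContinuous_iff.1
    (hf.2.uniformContinuous_of_continuous hf.1.continuous)
  refine tendsto_eLpNorm_of_forall_norm_le hK fun ε hε => ?_
  obtain ⟨δ, hδ, hfδ⟩ := hunif (ε / (2 * (|M| + 1))) (by positivity)
  filter_upwards [a.eventually_norm_prod_segment_sub_wilson_le v hK
      (ε := ε / (2 * (|C| + 1))) (by positivity),
    eventually_norm_vertex_sub_le v (lt_min one_pos (half_pos hδ))] with P hP hvert
  have hlast := hvert P.N le_rfl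
  rw [P.pt_last, hv, sub_zero] at hlast
  have happ : ∀ x, P.orderedProd (fun θ h => expDom (a.covD (h • v θ))) f x = _ := fun x =>
    a.prod_expDom_apply v P P.N hf x
  constructor
  · intro x hx
    rw [happ]
    set Q := ((List.range P.N).map fun j =>
        a.segment (P.step j • v (P.tag j)) (x + P.vertex v j)).prod
    have e1 : Q (f (x + P.vertex v P.N)) - a.wilson v x (f x) =
        (Q - a.wilson v x) (f (x + P.vertex v P.N)) +
          a.wilson v x (f (x + P.vertex v P.N) - f x) := by
      rw [sub_apply, map_sub]
      abel
    have e2 := (Q - a.wilson v x).le_of_opNorm_le_of_le (hP x hx)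
      ((hC (x + P.vertex v P.N)).trans (le_abs_self C))
    have e3 : ‖f (x + P.vertex v P.N) - f x‖ ≤ ε / (2 * (|M| + 1)) := by
      rw [← dist_eq_norm]
      refine (hfδ ?_).le
      rw [dist_eq_norm, add_sub_cancel_left]
      linarith [hlast.trans (min_le_right _ _)]
    have e4 := (a.wilson v x).le_of_opNorm_le_of_le ((hM x hx).trans (le_abs_self M)) e3
    have e5 : ε / (2 * (|C| + 1)) * |C| ≤ ε / 2 := by
      rw [div_mul_eq_mul_div, div_le_div_iff₀ (by positivity) (by positivity)]
      nlinarith [abs_nonneg C]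
    have e6 : |M| * (ε / (2 * (|M| + 1))) ≤ ε / 2 := by
      rw [mul_div_assoc', div_le_div_iff₀ (by positivity) (by positivity)]
      nlinarith [abs_nonneg M]
    rw [e1]
    exact (norm_add_le _ _).trans (by linarith)
  · intro x hx
    rw [mem_closedBall_zero_iff, not_le] at hx
    have h1 : f (x + P.vertex v P.N) = 0 := by
      refine (hR _ ?_).1
      have h2 := norm_sub_le (x + P.vertex v P.N) (P.vertex v P.N)
      rw [add_sub_cancel_right] at h2
      linarith [hlast.trans (min_le_left _ _)]
    rw [happ, h1, (hR x (by linarith)).1, map_zero, map_zero, sub_zero]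

/-! ### Gauge fields as connection forms -/

/-- The connection form `b_μ A_μ(x)` of a gauge field, matrices being regarded as operators. -/
def GaugeField.toConnection (A : GaugeField d n)
    (hA : ∀ μ i j, ContDiff ℝ 1 fun x => A μ x i j) : Connection d n where
  form x := ∑ μ, (EuclideanSpace.proj μ : Pos d →L[ℝ] ℝ).smulRight
    (Matrix.toEuclideanCLM (𝕜 := ℂ) (A μ x))
  contDiff := by
    have h1 : ∀ μ, ContDiff ℝ 1 fun x => Matrix.toEuclideanCLM (𝕜 := ℂ) (A μ x) := by
      intro μ
      have h2 : (fun x => Matrix.toEuclideanCLM (𝕜 := ℂ) (A μ x)) = fun x =>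
          ∑ i, ∑ j, A μ x i j • Matrix.toEuclideanCLM (𝕜 := ℂ) (Matrix.single i j (1 : ℂ)) := by
        ext1 x
        conv_lhs => rw [Matrix.matrix_eq_sum_single (A μ x)]
        simp only [map_sum, ← map_smul, Matrix.smul_single, smul_eq_mul, mul_one]
      rw [h2]
      exact ContDiff.sum fun i _ => ContDiff.sum fun j _ => (hA μ i j).smul contDiff_const
    refine contDiff_clm_apply_iff.2 fun b => ?_
    simp only [sum_apply, ContinuousLinearMap.smulRight_apply]
    exact ContDiff.sum fun μ _ => (h1 μ).const_smul _

theorem GaugeField.toConnection_form (A : GaugeField d n)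
    (hA : ∀ μ i j, ContDiff ℝ 1 fun x => A μ x i j) (x b : Pos d) :
    (A.toConnection hA).form x b = Matrix.toEuclideanCLM (𝕜 := ℂ) (∑ μ, b μ • A μ x) := by
  have h : ∀ (r : ℝ) (M : Matrix (Fin n) (Fin n) ℂ), Matrix.toEuclideanCLM (𝕜 := ℂ) (r • M) =
      r • Matrix.toEuclideanCLM (𝕜 := ℂ) M := fun r M => by
    rw [RCLike.real_smul_eq_coe_smul (K := ℂ) r M, map_smul,
      RCLike.real_smul_eq_coe_smul (K := ℂ) r (Matrix.toEuclideanCLM (𝕜 := ℂ) M)]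
  simp [toConnection, h]

theorem GaugeField.dirCovDeriv_eq (A : GaugeField d n)
    (hA : ∀ μ i j, ContDiff ℝ 1 fun x => A μ x i j) (c : Pos d) :
    dirCovDeriv A c = (A.toConnection hA).covD c := by
  ext1 f
  ext1 x
  have hc : ∑ μ, c μ • (EuclideanSpace.single μ (1 : ℝ) : Pos d) = c := by
    ext i
    simp [Finset.sum_apply, Pi.single_apply]
  simp only [dirCovDeriv, covDeriv, smul_add, Finset.sum_add_distrib, Connection.covD]
  congr 1
  · conv_rhs => rw [← hc, map_sum]
    simp only [map_smul]
  · simp only [toConnection, sum_apply, ContinuousLinearMap.smulRight_apply]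
    rfl

theorem continuous_toEuclideanCLM_symm :
    Continuous (Matrix.toEuclideanCLM (𝕜 := ℂ) (n := Fin n)).symm :=
  LinearMap.continuous_of_finiteDimensional
    ((Matrix.toEuclideanCLM (𝕜 := ℂ) (n := Fin n)).symm.toAlgEquiv.toLinearMap)

theorem continuous_toEuclideanCLM :
    Continuous (Matrix.toEuclideanCLM (𝕜 := ℂ) (n := Fin n)) :=
  LinearMap.continuous_of_finiteDimensional
    ((Matrix.toEuclideanCLM (𝕜 := ℂ) (n := Fin n)).toAlgEquiv.toLinearMap)

theorem toEuclideanCLM_exp (M : Matrix (Fin n) (Fin n) ℂ) :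
    Matrix.toEuclideanCLM (𝕜 := ℂ) (NormedSpace.exp M) =
      NormedSpace.exp (Matrix.toEuclideanCLM (𝕜 := ℂ) M) := by
  let _ : NormedRing (Matrix (Fin n) (Fin n) ℂ) := Matrix.linftyOpNormedRing
  let _ : NormedAlgebra ℂ (Matrix (Fin n) (Fin n) ℂ) := Matrix.linftyOpNormedAlgebra
  let _ : NormedAlgebra ℚ (Matrix (Fin n) (Fin n) ℂ) := Matrix.linftyOpNormedAlgebra
  have _ : CompleteSpace (Matrix (Fin n) (Fin n) ℂ) := FiniteDimensional.complete ℂ _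
  exact NormedSpace.map_exp (Matrix.toEuclideanCLM (𝕜 := ℂ) (n := Fin n))
    continuous_toEuclideanCLM M

theorem toEuclideanCLM_orderedProd (P : TaggedPartition)
    (F : ℝ → ℝ → Matrix (Fin n) (Fin n) ℂ) :
    Matrix.toEuclideanCLM (𝕜 := ℂ) (P.orderedProd F) =
      P.orderedProd fun θ h => Matrix.toEuclideanCLM (𝕜 := ℂ) (F θ h) := by
  rw [TaggedPartition.orderedProd_eq, map_list_prod, List.map_map]
  rfl

/-- Ordered products of matrix exponentials along a path converge, for a velocity that agrees with
the continuous function `w` on `[0, 2π]`. -/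
theorem GaugeField.tendsto_orderedProd_holonomyFactor (A : GaugeField d n)
    (hA : ∀ μ i j, ContDiff ℝ 1 fun x => A μ x i j) {v : ℝ → Pos d} (w : C(ℝ, Pos d))
    (hw : ∀ θ ∈ Icc 0 (2 * Real.pi), w θ = v θ) (x : Pos d) :
    Tendsto (fun P : TaggedPartition => P.orderedProd (holonomyFactor A v x)) meshFilter
      (𝓝 ((Matrix.toEuclideanCLM (𝕜 := ℂ)).symm ((A.toConnection hA).wilson w x))) := by
  have h1 : Tendsto (fun P : TaggedPartition =>
      Matrix.toEuclideanCLM (𝕜 := ℂ) (P.orderedProd (holonomyFactor A v x))) meshFilter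
      (𝓝 ((A.toConnection hA).wilson w x)) := by
    rw [Metric.tendsto_nhds]
    intro ε hε
    filter_upwards [(A.toConnection hA).eventually_norm_prod_exp_sub_wilson_le w
      (isCompact_singleton (x := x)) (half_pos hε)] with P hP
    have h2 : Matrix.toEuclideanCLM (𝕜 := ℂ) (P.orderedProd (holonomyFactor A v x)) =
        P.orderedProd (fun θ h => NormedSpace.exp (h • (A.toConnection hA).alongPath w x θ)) := by
      rw [toEuclideanCLM_orderedProd]
      refine P.orderedProd_congr fun θ hθ h => ?_
      have hpath : path w x θ = path v x θ := by
        rw [path, path]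
        congr 1
        refine intervalIntegral.integral_congr fun s hs => ?_
        rw [uIcc_of_le hθ.1] at hs
        exact hw s ⟨hs.1, hs.2.trans hθ.2⟩
      rw [holonomyFactor, toEuclideanCLM_exp, Connection.alongPath_apply, hpath,
        hw θ hθ, ← map_smul, toConnection_form]
      simp only [PiLp.smul_apply, smul_eq_mul, Finset.smul_sum, smul_smul]
    rw [h2, dist_eq_norm]
    exact (hP x rfl).trans_lt (half_lt_self hε)
  refine ((continuous_toEuclideanCLM_symm.tendsto _).comp h1).congr fun P => ?_
  exact (Matrix.toEuclideanCLM (𝕜 := ℂ)).symm_apply_apply _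

theorem GaugeField.toEuclideanCLM_holonomy (A : GaugeField d n)
    (hA : ∀ μ i j, ContDiff ℝ 1 fun x => A μ x i j) {v : ℝ → Pos d} (w : C(ℝ, Pos d))
    (hw : ∀ θ ∈ Icc 0 (2 * Real.pi), w θ = v θ) (x : Pos d) :
    holonomy A v x = (Matrix.toEuclideanCLM (𝕜 := ℂ)).symm ((A.toConnection hA).wilson w x) :=
  (A.tendsto_orderedProd_holonomyFactor hA w hw x).limUnder_eq

/-! ### Transport for a bounded Hermitian part -/

/-- If the Hermitian part of `B` is at most `κ`, then transport along `B` grows at most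
exponentially with rate `κ`: the square norm of `Φ(s)^* w` has derivative
`2 Re ⟨Φ^* w, B Φ^* w⟩`. -/
theorem norm_pexp_le (B : C(ℝ, End n)) {κ t : ℝ} (ht : 0 ≤ t)
    (hB : ∀ s ∈ Icc 0 t, ∀ w, (inner ℂ w (B s w)).re ≤ κ * ‖w‖ ^ 2) :
    ‖pexp B t‖ ≤ Real.exp (κ * t) := by
  rw [← (ContinuousLinearMap.adjoint (𝕜 := ℂ) (E := Col n) (F := Col n)).norm_map]
  refine ContinuousLinearMap.opNorm_le_bound _ (Real.exp_pos _).le fun w => ?_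
  set z : ℝ → Col n := fun s => ContinuousLinearMap.adjoint (pexp B s) w with hz
  have hzd : ∀ s, HasDerivAt z (ContinuousLinearMap.adjoint (B s) (z s)) s := by
    intro s
    have h1 : HasDerivAt (fun s => ContinuousLinearMap.adjoint (pexp B s))
        (ContinuousLinearMap.adjoint (pexp B s * B s)) s :=
      ((starL' ℝ : End n ≃L[ℝ] End n) : End n →L[ℝ] End n).hasFDerivAt.comp_hasDerivAt s
        (hasDerivAt_pexp B s)
    have h2 := hasDerivAt_end_apply h1 (hasDerivAt_const s w)
    rw [map_zero, add_zero, ContinuousLinearMap.mul_def, ContinuousLinearMap.adjoint_comp] at h2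
    exact h2
  set g : ℝ → ℝ := fun s => (inner ℂ (z s) (z s)).re * Real.exp (-(2 * κ) * s) with hg
  have hgd : ∀ s, HasDerivAt g ((2 * (inner ℂ (z s) (B s (z s))).re) * Real.exp (-(2 * κ) * s) +
      (inner ℂ (z s) (z s)).re * (Real.exp (-(2 * κ) * s) * -(2 * κ))) s := by
    intro s
    have h1 := Complex.reCLM.hasFDerivAt.comp_hasDerivAt s ((hzd s).inner ℂ (hzd s))
    have h2 : HasDerivAt (fun s : ℝ => Real.exp (-(2 * κ) * s))
        (Real.exp (-(2 * κ) * s) * -(2 * κ)) s := by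
      simpa using ((hasDerivAt_id s).const_mul (-(2 * κ))).exp
    refine (h1.mul h2).congr_deriv ?_
    congr 2
    rw [ContinuousLinearMap.adjoint_inner_left (B s) (z s) (z s),
      ContinuousLinearMap.adjoint_inner_right (B s) (z s) (z s), Complex.reCLM_apply,
      Complex.add_re, ← inner_conj_symm (B s (z s)) (z s), Complex.conj_re]
    ring
  have hanti : AntitoneOn g (Icc 0 t) := by
    refine antitoneOn_of_deriv_nonpos (convex_Icc 0 t)
      (fun s _ => (hgd s).continuousAt.continuousWithinAt)
      (fun s _ => (hgd s).differentiableAt.differentiableWithinAt) fun s hs => ?_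
    rw [(hgd s).deriv]
    have h1 := hB s (interior_subset hs) (z s)
    have h2 : (inner ℂ (z s) (z s)).re = ‖z s‖ ^ 2 := inner_self_eq_norm_sq (𝕜 := ℂ) (z s)
    rw [h2]
    nlinarith [Real.exp_pos (-(2 * κ) * s)]
  have h1 := hanti ⟨le_rfl, ht⟩ ⟨ht, le_rfl⟩ ht
  have h2 : ∀ s, (inner ℂ (z s) (z s)).re = ‖z s‖ ^ 2 :=
    fun s => inner_self_eq_norm_sq (𝕜 := ℂ) (z s)
  have h3 : ‖z 0‖ ≤ ‖w‖ := by
    simp only [hz, pexp_zero]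
    rw [← ContinuousLinearMap.star_eq_adjoint, star_one, one_apply_eq_self]
  simp only [hg, h2, mul_zero, Real.exp_zero, mul_one] at h1
  have h4 : ‖z t‖ ^ 2 ≤ (Real.exp (κ * t) * ‖w‖) ^ 2 := by
    have h5 : Real.exp (-(2 * κ) * t) * Real.exp (κ * t) ^ 2 = 1 := by
      rw [← Real.exp_nat_mul, ← Real.exp_add]
      convert Real.exp_zero using 2
      push_cast
      ring
    calc ‖z t‖ ^ 2 = (‖z t‖ ^ 2 * Real.exp (-(2 * κ) * t)) * Real.exp (κ * t) ^ 2 := by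
          rw [mul_assoc, h5, mul_one]
      _ ≤ ‖w‖ ^ 2 * Real.exp (κ * t) ^ 2 := by
          gcongr
          exact h1.trans (by gcongr)
      _ = _ := by ring
  exact abs_le_of_sq_le_sq' h4 (by positivity) |>.2

/-- The Hermitian part of the connection form is bounded by `κ`. The one-sided inequality suffices,
as `b` may be replaced by `-b`. -/
def Connection.HermBound (a : Connection d n) (κ : ℝ) : Prop :=
  0 ≤ κ ∧ ∀ x b w, (inner ℂ w (a.form x b w)).re ≤ κ * ‖b‖ * ‖w‖ ^ 2

theorem Connection.HermBound.norm_segment_le {a : Connection d n} {κ : ℝ} (ha : a.HermBound κ)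
    (b x : Pos d) : ‖a.segment b x‖ ≤ Real.exp (κ * ‖b‖) := by
  have h := norm_pexp_le (a.along b x) zero_le_one (κ := κ * ‖b‖)
    fun s _ w => ha.2 (x + s • b) b w
  rwa [mul_one] at h

theorem Connection.HermBound.norm_wilson_le {a : Connection d n} {κ : ℝ} (ha : a.HermBound κ)
    {v : C(ℝ, Pos d)} {V : ℝ} (hV : ∀ θ ∈ Icc 0 (2 * Real.pi), ‖v θ‖ ≤ V) (x : Pos d) :
    ‖a.wilson v x‖ ≤ Real.exp (κ * V * (2 * Real.pi)) := by
  refine norm_pexp_le _ Real.two_pi_pos.le fun s hs w => (ha.2 _ _ w).trans ?_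
  have := hV s hs
  have := ha.1
  gcongr

/-! ### Operators on the Hilbert space -/

theorem memLp_mul {M : Pos d → End n} (hM : Continuous M) {C : ℝ} (hC : ∀ x, ‖M x‖ ≤ C)
    (ψ : Hilb d n) : MemLp (fun x => M x (ψ x)) 2 volume :=
  (Lp.memLp ψ).of_le_mul (c := C)
    ((isBoundedBilinearMap_apply (𝕜 := ℂ) (E := Col n)
      (F := Col n)).continuous.comp_aestronglyMeasurable
      (hM.aestronglyMeasurable.prodMk (Lp.aestronglyMeasurable ψ)))
    (ae_of_all _ fun x => (M x).le_of_opNorm_le (hC x) _)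

/-- Multiplication by a bounded continuous operator-valued function. -/
def mulOp {M : Pos d → End n} (hM : Continuous M) {C : ℝ} (hC : ∀ x, ‖M x‖ ≤ C) :
    Hilb d n →L[ℂ] Hilb d n :=
  LinearMap.mkContinuous
    { toFun := fun ψ => (memLp_mul hM hC ψ).toLp _
      map_add' := fun ψ χ => by
        rw [← MemLp.toLp_add, MemLp.toLp_eq_toLp_iff]
        filter_upwards [Lp.coeFn_add ψ χ] with x hx
        rw [hx, Pi.add_apply, map_add, Pi.add_apply]
      map_smul' := fun c ψ => by
        rw [RingHom.id_apply, ← MemLp.toLp_const_smul, MemLp.toLp_eq_toLp_iff]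
        filter_upwards [Lp.coeFn_smul c ψ] with x hx
        rw [hx, Pi.smul_apply, map_smul, Pi.smul_apply] } C fun ψ => by
    refine Lp.norm_le_mul_norm_of_ae_le_mul ?_
    filter_upwards [(memLp_mul hM hC ψ).coeFn_toLp] with x hx
    simp only [LinearMap.coe_mk, AddHom.coe_mk]
    rw [hx]
    exact (M x).le_of_opNorm_le (hC x) _

theorem coeFn_mulOp {M : Pos d → End n} (hM : Continuous M) {C : ℝ} (hC : ∀ x, ‖M x‖ ≤ C)
    (ψ : Hilb d n) : mulOp hM hC ψ =ᵐ[volume] fun x => M x (ψ x) :=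
  (memLp_mul hM hC ψ).coeFn_toLp

theorem norm_mulOp_le {M : Pos d → End n} (hM : Continuous M) {C : ℝ} (hC : ∀ x, ‖M x‖ ≤ C) :
    ‖mulOp hM hC‖ ≤ C :=
  LinearMap.mkContinuous_norm_le _ ((norm_nonneg _).trans (hC 0)) _

/-- Translation `ψ ↦ ψ(· + c)` on the Hilbert space. -/
def translation (c : Pos d) : Hilb d n →L[ℂ] Hilb d n :=
  (Lp.compMeasurePreservingₗᵢ ℂ (· + c)
    (measurePreserving_add_right volume c)).toContinuousLinearMap

theorem coeFn_translation (c : Pos d) (ψ : Hilb d n) :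
    translation c ψ =ᵐ[volume] fun x => ψ (x + c) :=
  Lp.coeFn_compMeasurePreserving ψ (measurePreserving_add_right volume c)

theorem norm_translation_le (c : Pos d) : ‖(translation c : Hilb d n →L[ℂ] Hilb d n)‖ ≤ 1 :=
  LinearIsometry.norm_toContinuousLinearMap_le _

theorem Connection.continuous_segment (a : Connection d n) (c : Pos d) :
    Continuous (a.segment c) :=
  a.contDiff_segment.continuous.comp (f := fun x => (c, x)) (by fun_prop)

/-- The bounded operator `exp (c · D)` on the Hilbert space. -/
def Connection.shiftOp (a : Connection d n) {κ : ℝ} (ha : a.HermBound κ) (c : Pos d) :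
    Hilb d n →L[ℂ] Hilb d n :=
  mulOp (a.continuous_segment c) (ha.norm_segment_le c) * translation c

theorem Connection.norm_shiftOp_le (a : Connection d n) {κ : ℝ} (ha : a.HermBound κ) (c : Pos d) :
    ‖a.shiftOp ha c‖ ≤ Real.exp (κ * ‖c‖) := by
  refine (norm_mul_le _ _).trans ?_
  exact (mul_le_mul (norm_mulOp_le _ _) (norm_translation_le c) (norm_nonneg _)
    (Real.exp_pos _).le).trans_eq (mul_one _)

theorem Connection.shiftOp_toLp (a : Connection d n) {κ : ℝ} (ha : a.HermBound κ) (c : Pos d)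
    {f : Pos d → Col n} (hf : IsC1c f) :
    a.shiftOp ha c (hf.memLp.toLp f) = (hf.shift a c).memLp.toLp _ := by
  refine Lp.ext ?_
  have h1 := (measurePreserving_add_right volume c).quasiMeasurePreserving.ae
    hf.memLp.coeFn_toLp
  filter_upwards [coeFn_mulOp (a.continuous_segment c) (ha.norm_segment_le c)
    (translation c (hf.memLp.toLp f)), coeFn_translation c (hf.memLp.toLp f),
    (hf.shift a c).memLp.coeFn_toLp, h1] with x h2 h3 h4 h5
  rw [shiftOp, mul_apply_eq_comp, h2, h3, h4, h5]
  rfl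

theorem dense_setOf_toLp_isC1c :
    Dense {ψ : Hilb d n | ∃ f, ∃ hf : IsC1c f, hf.memLp.toLp f = ψ} := by
  refine (Lp.dense_hasCompactSupport_contDiff (E := Pos d) (F := Col n) (μ := volume) (p := 2)
    (by simp)).mono ?_
  rintro ψ ⟨g, hg, hg1, hg2⟩
  have hgC : IsC1c g := ⟨hg2.of_le (by simp), hg1⟩
  exact ⟨g, hgC, Lp.ext (hgC.memLp.coeFn_toLp.trans hg.symm)⟩

theorem clm_eq_of_toLp_eq {S T : Hilb d n →L[ℂ] Hilb d n}
    (h : ∀ f, ∀ hf : IsC1c f, S (hf.memLp.toLp f) = T (hf.memLp.toLp f)) : S = T := by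
  refine ContinuousLinearMap.coeFn_injective
    (S.continuous.ext_on dense_setOf_toLp_isC1c T.continuous ?_)
  rintro _ ⟨f, hf, rfl⟩
  exact h f hf

/-- Uniformly bounded operators that converge strongly on a dense set converge strongly. -/
theorem tendsto_apply_of_dense {H : Type*} [NormedAddCommGroup H] [NormedSpace ℂ H] {ι : Type*}
    {l : Filter ι} {S : ι → H →L[ℂ] H} {T : H →L[ℂ] H} {C : ℝ} (hS : ∀ᶠ i in l, ‖S i‖ ≤ C)
    {s : Set H} (hs : Dense s) (h : ∀ φ ∈ s, Tendsto (fun i => S i φ) l (𝓝 (T φ))) (ψ : H) :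
    Tendsto (fun i => S i ψ) l (𝓝 (T ψ)) := by
  rw [Metric.tendsto_nhds]
  intro ε hε
  set c := |C| + ‖T‖ + 1 with hc
  have hcpos : 0 < c := by positivity
  obtain ⟨φ, hφs, hφ⟩ := hs.exists_dist_lt ψ (ε := ε / (2 * c)) (by positivity)
  filter_upwards [hS, Metric.tendsto_nhds.1 (h φ hφs) (ε / 2) (half_pos hε)] with i hi h2
  rw [dist_eq_norm] at hφ h2 ⊢
  have e : S i ψ - T ψ = S i (ψ - φ) + (S i φ - T φ) - T (ψ - φ) := by
    rw [map_sub, map_sub]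
    abel
  have e1 := (S i).le_of_opNorm_le (hi.trans (le_abs_self C)) (ψ - φ)
  have e2 := T.le_opNorm (ψ - φ)
  have e3 : c * ‖ψ - φ‖ < ε / 2 := by
    have := mul_lt_mul_of_pos_left hφ hcpos
    have h4 : c * (ε / (2 * c)) = ε / 2 := by field_simp
    linarith
  rw [e]
  have e4 := norm_sub_le (S i (ψ - φ) + (S i φ - T φ)) (T (ψ - φ))
  have e5 := norm_add_le (S i (ψ - φ)) (S i φ - T φ)
  have e6 : c * ‖ψ - φ‖ = |C| * ‖ψ - φ‖ + ‖T‖ * ‖ψ - φ‖ + ‖ψ - φ‖ := by rw [hc]; ring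
  linarith [norm_nonneg (ψ - φ)]

theorem Connection.hasDerivAt_shiftOp (a : Connection d n) {κ : ℝ} (ha : a.HermBound κ)
    (c : Pos d) {f : Pos d → Col n} (hf : IsC1c f) (t : ℝ) :
    HasDerivAt (fun t : ℝ => a.shiftOp ha (t • c) (hf.memLp.toLp f))
      (((hf.shift a (t • c)).memLp_covD a c).toLp _) t := by
  have h : (fun t : ℝ => a.shiftOp ha (t • c) (hf.memLp.toLp f)) =
      fun t : ℝ => (hf.shift a (t • c)).memLp.toLp _ := funext fun t => a.shiftOp_toLp ha _ hf
  rw [h]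
  exact (a.isExpOrbit_shift c hf).hasDerivAt t

/-- The operators `exp (t c · D)` form a strongly continuous group generated by an extension of
`c · D`. -/
theorem Connection.isExpGroup_shiftOp (a : Connection d n) {κ : ℝ} (ha : a.HermBound κ)
    (c : Pos d) : IsExpGroup (a.covD c) fun t => a.shiftOp ha (t • c) where
  map_zero := by
    refine clm_eq_of_toLp_eq fun f hf => ?_
    rw [a.shiftOp_toLp ha _ hf, one_apply_eq_self]
    congr 1
    simp
  map_add s t := by
    refine clm_eq_of_toLp_eq fun f hf => ?_
    rw [mul_apply_eq_comp, a.shiftOp_toLp ha _ hf, a.shiftOp_toLp ha _ hf,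
      a.shiftOp_toLp ha _ (hf.shift a _)]
    congr 1
    exact a.shift_add c s t f
  continuous ψ := by
    rw [continuous_iff_continuousAt]
    intro t
    refine tendsto_apply_of_dense (C := Real.exp (κ * ((|t| + 1) * ‖c‖))) ?_
      dense_setOf_toLp_isC1c ?_ ψ
    · filter_upwards [Metric.ball_mem_nhds t one_pos] with s hs
      refine (a.norm_shiftOp_le ha _).trans (Real.exp_le_exp.2 ?_)
      rw [norm_smul]
      have h1 : ‖s‖ ≤ |t| + 1 := by
        rw [mem_ball_iff_norm] at hs
        have := norm_sub_norm_le s t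
        rw [Real.norm_eq_abs t] at this
        linarith
      have := ha.1
      gcongr
    · rintro _ ⟨f, hf, rfl⟩
      exact (a.hasDerivAt_shiftOp ha c hf t).continuousAt
  generator f hf ψ χ hψ hχ := by
    have h1 : ψ = hf.memLp.toLp f := Lp.ext (hψ.trans hf.memLp.coeFn_toLp.symm)
    have h2 : χ = ((hf.shift a ((0 : ℝ) • c)).memLp_covD a c).toLp _ := by
      refine Lp.ext (hχ.trans ?_)
      refine EventuallyEq.trans ?_ (MemLp.coeFn_toLp _).symm
      simp
    rw [h1, h2]
    exact a.hasDerivAt_shiftOp ha c hf 0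

/-- Strongly continuous groups are bounded near zero, by the uniform boundedness principle. -/
theorem IsExpGroup.exists_norm_le {L : (Pos d → Col n) → (Pos d → Col n)}
    {U : ℝ → (Hilb d n →L[ℂ] Hilb d n)} (hU : IsExpGroup L U) :
    ∃ C, ∀ s ∈ Icc (-1 : ℝ) 1, ‖U s‖ ≤ C := by
  obtain ⟨C, hC⟩ := banach_steinhaus (g := fun s : Icc (-1 : ℝ) 1 => U s) fun ψ => by
    obtain ⟨C, hC⟩ := (isCompact_Icc (a := (-1 : ℝ)) (b := 1)).exists_bound_of_continuousOn
      (hU.continuous ψ).continuousOn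
    exact ⟨C, fun s => hC s s.2⟩
  exact ⟨C, fun s hs => hC ⟨s, hs⟩⟩

/-- If a curve starts in the domain with the derivative prescribed by the generator, undoing the
group along the curve cancels the derivative at time zero. -/
theorem IsExpGroup.hasDerivAt_neg_apply {L : (Pos d → Col n) → (Pos d → Col n)}
    {U : ℝ → (Hilb d n →L[ℂ] Hilb d n)} (hU : IsExpGroup L U) {w : ℝ → Hilb d n} {χ : Hilb d n}
    (hw : HasDerivAt w χ 0) (hgen : HasDerivAt (fun t => U t (w 0)) χ 0) :
    HasDerivAt (fun h => U (-h) (w h)) 0 0 := by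
  obtain ⟨C, hC⟩ := hU.exists_norm_le
  -- split `U(-h) w(h) = U(-h) (w(h) - w(0)) + U(-h) w(0)`; the derivatives are `χ` and `-χ`
  have h1 : HasDerivAt (fun h => U (-h) (w 0)) (-χ) 0 := by
    have h2 : HasDerivAt (fun t => U t (w 0)) χ (-0) := by rwa [neg_zero]
    have h3 := h2.scomp (0 : ℝ) (hasDerivAt_neg (0 : ℝ))
    rw [neg_one_smul] at h3
    exact h3
  have h3 : HasDerivAt (fun h => U (-h) (w h - w 0)) χ 0 := by
    rw [hasDerivAt_iff_tendsto_slope_zero] at hw ⊢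
    simp only [zero_add] at hw ⊢
    have h4 : Tendsto (fun h : ℝ => U (-h) χ) (𝓝[≠] 0) (𝓝 χ) := by
      have h5 : Continuous fun h : ℝ => U (-h) χ := (hU.continuous χ).comp continuous_neg
      have h6 := h5.tendsto 0
      simp only [neg_zero, hU.map_zero, one_apply_eq_self] at h6
      exact h6.mono_left nhdsWithin_le_nhds
    have h7 : Tendsto (fun h : ℝ => U (-h) (h⁻¹ • (w h - w 0) - χ)) (𝓝[≠] 0) (𝓝 0) := by
      rw [tendsto_iff_norm_sub_tendsto_zero] at hw
      refine squeeze_zero_norm' (a := fun h => C * ‖h⁻¹ • (w h - w 0) - χ‖) ?_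
        (by simpa using hw.const_mul C)
      have hball : ∀ᶠ h : ℝ in 𝓝[≠] 0, h ∈ Metric.ball (0 : ℝ) 1 :=
        mem_nhdsWithin_of_mem_nhds (Metric.ball_mem_nhds 0 one_pos)
      filter_upwards [hball] with h hh
      rw [mem_ball_zero_iff, Real.norm_eq_abs, abs_lt] at hh
      exact (U (-h)).le_of_opNorm_le (hC _ ⟨by linarith, by linarith⟩) _
    have h8 := h7.add h4
    rw [zero_add] at h8
    refine h8.congr fun h => ?_
    rw [← _root_.map_add (U (-h)), sub_add_cancel, neg_zero, sub_self, _root_.map_zero, sub_zero]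
    exact ((U (-h)).restrictScalars ℝ).map_smul _ _
  have h9 := h3.add h1
  rw [add_neg_cancel] at h9
  refine h9.congr_of_eventuallyEq (Eventually.of_forall fun h => ?_)
  simp

/-- A group whose generator extends `c · D` agrees on the domain with the orbits of `c · D`, since
`U(-t) u(t)` is constant along an orbit `u`; by density it is unique. -/
theorem IsExpGroup.eq_shiftOp {a : Connection d n} {κ : ℝ} (ha : a.HermBound κ) {c : Pos d}
    {U : ℝ → (Hilb d n →L[ℂ] Hilb d n)} (hU : IsExpGroup (a.covD c) U) :
    U = fun t => a.shiftOp ha (t • c) := by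
  funext t
  refine clm_eq_of_toLp_eq fun f hf => ?_
  have hV := a.isExpGroup_shiftOp ha c
  set y : ℝ → Hilb d n := fun t => U (-t) (a.shiftOp ha (t • c) (hf.memLp.toLp f)) with hy
  have hyd : ∀ t, HasDerivAt y 0 t := by
    intro t
    have hg := hf.shift a (t • c)
    have hwd : HasDerivAt (fun h : ℝ => a.shiftOp ha (h • c) (hg.memLp.toLp _))
        ((hg.memLp_covD a c).toLp _) 0 :=
      hV.generator _ hg _ _ hg.memLp.coeFn_toLp (hg.memLp_covD a c).coeFn_toLp
    have hw0 : a.shiftOp ha ((0 : ℝ) • c) (hg.memLp.toLp _) = hg.memLp.toLp _ :=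
      congrArg (fun T : Hilb d n →L[ℂ] Hilb d n => T (hg.memLp.toLp _)) hV.map_zero
    have h1 := hU.hasDerivAt_neg_apply hwd (by
      rw [hw0]
      exact hU.generator _ hg _ _ hg.memLp.coeFn_toLp (hg.memLp_covD a c).coeFn_toLp)
    have h2 := ((U (-t)).restrictScalars ℝ).hasFDerivAt.comp_hasDerivAt (0 : ℝ) h1
    rw [_root_.map_zero] at h2
    have h3 : HasDerivAt (fun h => y (t + h)) 0 0 := by
      refine h2.congr_of_eventuallyEq (Eventually.of_forall fun h => ?_)
      simp only [hy, Function.comp_apply, ContinuousLinearMap.coe_restrictScalars']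
      rw [neg_add, hU.map_add, mul_apply_eq_comp, ← a.shiftOp_toLp ha _ hf, ← mul_apply_eq_comp
        (a.shiftOp ha (h • c)), add_comm t h]
      congr 3
      exact hV.map_add h t
    have h4 : HasDerivAt (fun s => y (t + (s - t))) 0 t := by
      have h5 : HasDerivAt (fun h => y (t + h)) 0 (t - t) := by rwa [sub_self]
      exact h5.comp_sub_const t t
    simpa using h4
  have hconst := is_const_of_deriv_eq_zero (fun t => (hyd t).differentiableAt)
    (fun t => (hyd t).deriv) t 0
  have h0 : y 0 = hf.memLp.toLp f := by
    have h1 := congrArg (fun T : Hilb d n →L[ℂ] Hilb d n => T (hf.memLp.toLp f)) hV.map_zero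
    simp only [one_apply_eq_self] at h1
    simp only [hy]
    rw [h1, neg_zero, hU.map_zero, one_apply_eq_self]
  have h1 := congrArg (U t) (hconst.trans h0)
  simp only [hy] at h1
  rw [← mul_apply_eq_comp, ← hU.map_add, add_neg_cancel, hU.map_zero, one_apply_eq_self] at h1
  exact h1.symm

theorem Connection.existsUnique_isExpGroup (a : Connection d n) {κ : ℝ} (ha : a.HermBound κ)
    (c : Pos d) : ∃! U : ℝ → (Hilb d n →L[ℂ] Hilb d n), IsExpGroup (a.covD c) U :=
  ⟨_, a.isExpGroup_shiftOp ha c, fun _ hU => hU.eq_shiftOp ha⟩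

theorem Connection.expHilb_covD (a : Connection d n) {κ : ℝ} (ha : a.HermBound κ)
    (c : Pos d) : expHilb (a.covD c) = a.shiftOp ha c := by
  have h : ∃ U, IsExpGroup (a.covD c) U := ⟨_, a.isExpGroup_shiftOp ha c⟩
  rw [expHilb, dif_pos h, h.choose_spec.eq_shiftOp ha]
  simp only [one_smul]

/-! ### The operator-holonomy identity on the Hilbert space -/

theorem Connection.prod_expHilb_toLp (a : Connection d n) {κ : ℝ} (ha : a.HermBound κ)
    (v : ℝ → Pos d) (P : TaggedPartition) (k : ℕ) {f : Pos d → Col n} (hf : IsC1c f) :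
    ((List.range k).map fun j => expHilb (a.covD (P.step j • v (P.tag j)))).prod (hf.memLp.toLp f)
      =ᵐ[volume] ((List.range k).map fun j => expDom (a.covD (P.step j • v (P.tag j)))).prod f := by
  induction k generalizing f with
  | zero => exact hf.memLp.coeFn_toLp
  | succ k ih =>
    rw [prod_map_range_succ, prod_map_range_succ, mul_apply_eq_comp, a.expHilb_covD ha,
      a.shiftOp_toLp ha _ hf]
    refine (ih (hf.shift a _)).trans (EventuallyEq.of_eq ?_)
    rw [← a.expDom_covD _ hf]
    rfl

theorem Connection.norm_prod_expHilb_le (a : Connection d n) {κ : ℝ} (ha : a.HermBound κ)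
    {v : ℝ → Pos d} {V : ℝ} (hV : ∀ θ ∈ Icc 0 (2 * Real.pi), ‖v θ‖ ≤ V) (P : TaggedPartition)
    {k : ℕ} (hk : k ≤ P.N) :
    ‖((List.range k).map fun j => expHilb (a.covD (P.step j • v (P.tag j)))).prod‖ ≤
      Real.exp (κ * V * P.pt k) := by
  induction k with
  | zero =>
    rw [P.pt_zero, mul_zero, Real.exp_zero]
    exact ContinuousLinearMap.norm_id_le
  | succ k ih =>
    have hkN : k < P.N := hk
    have hstep := P.step_nonneg hkN
    have hvk := hV _ (P.tag_mem_Icc hkN)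
    have h1 : ‖expHilb (a.covD (P.step k • v (P.tag k)))‖ ≤ Real.exp (κ * V * P.step k) := by
      rw [a.expHilb_covD ha]
      refine (a.norm_shiftOp_le ha _).trans (Real.exp_le_exp.2 ?_)
      rw [norm_smul, Real.norm_of_nonneg hstep, mul_assoc, mul_comm V]
      have := ha.1
      gcongr
    rw [prod_map_range_succ]
    refine (norm_mul_le _ _).trans ((mul_le_mul (ih hkN.le) h1 (norm_nonneg _)
      (Real.exp_pos _).le).trans_eq ?_)
    rw [← Real.exp_add, ← mul_add, TaggedPartition.step, add_sub_cancel]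

/-- The ordered products of the operators `exp (h v · D)` are uniformly bounded and converge on
`C¹_c`, hence they converge strongly to multiplication by the holonomy. -/
theorem Connection.exists_tendsto_orderedProd_expHilb (a : Connection d n) {κ : ℝ}
    (ha : a.HermBound κ) (v : C(ℝ, Pos d)) (hv : ∫ θ in (0 : ℝ)..(2 * Real.pi), v θ = 0) :
    ∃ T : Hilb d n →L[ℂ] Hilb d n,
      (∀ ψ, Tendsto
        (fun P : TaggedPartition => P.orderedProd (fun θ h => expHilb (a.covD (h • v θ))) ψ)
        meshFilter (𝓝 (T ψ))) ∧
      ∀ ψ, T ψ =ᵐ[volume] fun x => a.wilson v x (ψ x) := by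
  obtain ⟨V, hV⟩ := (isCompact_Icc (a := 0) (b := 2 * Real.pi)).exists_bound_of_continuousOn
    v.continuous.continuousOn
  refine ⟨mulOp (a.continuous_wilson v) (ha.norm_wilson_le hV), fun ψ => ?_, fun ψ =>
    coeFn_mulOp _ _ ψ⟩
  refine tendsto_apply_of_dense (C := Real.exp (κ * V * (2 * Real.pi)))
    (Eventually.of_forall fun P => ?_) dense_setOf_toLp_isC1c ?_ ψ
  · rw [← P.pt_last]
    exact a.norm_prod_expHilb_le ha hV P le_rfl
  · rintro _ ⟨f, hf, rfl⟩
    rw [tendsto_iff_norm_sub_tendsto_zero]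
    have h1 := (ENNReal.tendsto_toReal ENNReal.zero_ne_top).comp
      (a.tendsto_orderedProd_expDom v hv hf)
    rw [ENNReal.toReal_zero] at h1
    refine h1.congr fun P => ?_
    rw [Lp.norm_def, Function.comp_apply]
    congr 1
    refine eLpNorm_congr_ae ?_
    filter_upwards [Lp.coeFn_sub (P.orderedProd (fun θ h => expHilb (a.covD (h • v θ)))
      (hf.memLp.toLp f)) (mulOp (a.continuous_wilson v) (ha.norm_wilson_le hV) (hf.memLp.toLp f)),
      a.prod_expHilb_toLp ha v P P.N hf, coeFn_mulOp (a.continuous_wilson v)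
        (ha.norm_wilson_le hV) (hf.memLp.toLp f), hf.memLp.coeFn_toLp] with x h1 h2 h3 h4
    rw [h1, Pi.sub_apply, h3, h4]
    exact congrArg (fun z => z - a.wilson v x (f x)) h2.symm

theorem GaugeField.hermBound_toConnection (A : GaugeField d n)
    (hA : ∀ μ i j, ContDiff ℝ 1 fun x => A μ x i j) {K : ℝ}
    (hK : ∀ μ x i j, ‖(A μ x + (A μ x)ᴴ) i j‖ ≤ K) :
    ∃ κ, (A.toConnection hA).HermBound κ := by
  set E : Fin n → Fin n → End n := fun i j =>
    Matrix.toEuclideanCLM (𝕜 := ℂ) (Matrix.single i j (1 : ℂ)) with hE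
  set K' : ℝ := ∑ i, ∑ j, |K| * ‖E i j‖ with hK'
  have hK'0 : 0 ≤ K' := by positivity
  have h1 : ∀ μ x, ‖Matrix.toEuclideanCLM (𝕜 := ℂ) (A μ x + (A μ x)ᴴ)‖ ≤ K' := by
    intro μ x
    rw [Matrix.matrix_eq_sum_single (A μ x + (A μ x)ᴴ), map_sum]
    refine norm_sum_le_of_le _ fun i _ => ?_
    rw [map_sum]
    refine norm_sum_le_of_le _ fun j _ => ?_
    have h2 : Matrix.single i j ((A μ x + (A μ x)ᴴ) i j) =
        (A μ x + (A μ x)ᴴ) i j • Matrix.single i j (1 : ℂ) := by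
      rw [Matrix.smul_single, smul_eq_mul, mul_one]
    rw [h2, map_smul, norm_smul]
    gcongr
    exact (hK μ x i j).trans (le_abs_self K)
  have h2 : ∀ μ x (w : Col n),
      |(inner ℂ w (Matrix.toEuclideanCLM (𝕜 := ℂ) (A μ x) w)).re| ≤ K' * ‖w‖ ^ 2 := by
    intro μ x w
    have h3 : (inner ℂ w (Matrix.toEuclideanCLM (𝕜 := ℂ) (A μ x + (A μ x)ᴴ) w)).re =
        2 * (inner ℂ w (Matrix.toEuclideanCLM (𝕜 := ℂ) (A μ x) w)).re := by
      rw [map_add, ← Matrix.star_eq_conjTranspose, map_star, add_apply, inner_add_right,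
        Complex.add_re, ContinuousLinearMap.star_eq_adjoint,
        ContinuousLinearMap.adjoint_inner_right, ← inner_conj_symm w, Complex.conj_re]
      ring
    have h4 : |(inner ℂ w (Matrix.toEuclideanCLM (𝕜 := ℂ) (A μ x + (A μ x)ᴴ) w)).re| ≤
        ‖w‖ * (K' * ‖w‖) :=
      (Complex.abs_re_le_norm _).trans ((norm_inner_le_norm _ _).trans (by
        gcongr
        exact ContinuousLinearMap.le_of_opNorm_le _ (h1 μ x) w))
    rw [h3, abs_mul, abs_two] at h4
    nlinarith [abs_nonneg (inner ℂ w (Matrix.toEuclideanCLM (𝕜 := ℂ) (A μ x) w)).re]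
  refine ⟨d * K', by positivity, fun x b w => ?_⟩
  have h3 : (inner ℂ w ((A.toConnection hA).form x b w)).re =
      ∑ μ, b μ * (inner ℂ w (Matrix.toEuclideanCLM (𝕜 := ℂ) (A μ x) w)).re := by
    simp only [toConnection, sum_apply, ContinuousLinearMap.smulRight_apply, smul_apply,
      inner_sum, Complex.re_sum]
    refine Finset.sum_congr rfl fun μ _ => ?_
    rw [RCLike.real_smul_eq_coe_smul (K := ℂ), inner_smul_right]
    simp
  rw [h3]
  calc ∑ μ, b μ * (inner ℂ w (Matrix.toEuclideanCLM (𝕜 := ℂ) (A μ x) w)).re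
      ≤ ∑ _μ : Fin d, ‖b‖ * (K' * ‖w‖ ^ 2) := by
        refine Finset.sum_le_sum fun μ _ => (le_abs_self _).trans ?_
        rw [abs_mul]
        exact mul_le_mul (PiLp.norm_apply_le b μ) (h2 μ x w) (abs_nonneg _) (norm_nonneg _)
    _ = d * K' * ‖b‖ * ‖w‖ ^ 2 := by
        rw [Finset.sum_const, Finset.card_univ, Fintype.card_fin, nsmul_eq_mul]
        ring

end OperatorHolonomy

end

theorem mainTheorem1 (d n : ℕ) (A : GaugeField d n)
    (hA : ∀ μ i j, ContDiff ℝ 1 fun x => A μ x i j)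
    (v : ℝ → Pos d) (hv : ContDiffOn ℝ ∞ v (Icc 0 (2 * Real.pi)))
    (hclosed : ∫ θ in (0 : ℝ)..(2 * Real.pi), v θ = 0) :
    -- the holonomy is well defined at every base point
    (∀ x, Tendsto (fun P : TaggedPartition => P.orderedProd (holonomyFactor A v x)) meshFilter
      (𝓝 (holonomy A v x))) ∧
    -- the identity on the dense domain, for every gauge field
    (∀ c f, IsC1c f → ∃! u, IsExpOrbit (dirCovDeriv A c) f u) ∧
    (∀ f, IsC1c f → Tendsto
      (fun P : TaggedPartition => eLpNorm
        (fun x => P.orderedProd (fun θ h => expDom (dirCovDeriv A (h • v θ))) f x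
          - act (holonomy A v x) (f x)) 2 volume)
      meshFilter (𝓝 0)) ∧
    -- the identity of bounded operators on the Hilbert space
    ((∃ K : ℝ, ∀ μ x i j, ‖(A μ x + (A μ x)ᴴ) i j‖ ≤ K) →
      (∀ c, ∃! U : ℝ → (Hilb d n →L[ℂ] Hilb d n), IsExpGroup (dirCovDeriv A c) U) ∧
      ∃ T : Hilb d n →L[ℂ] Hilb d n,
        (∀ ψ, Tendsto
          (fun P : TaggedPartition =>
            P.orderedProd (fun θ h => expHilb (dirCovDeriv A (h • v θ))) ψ)
          meshFilter (𝓝 (T ψ))) ∧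
        ∀ ψ, T ψ =ᵐ[volume] fun x => act (holonomy A v x) (ψ x)) := by
  have h0 : (0 : ℝ) ≤ 2 * Real.pi := Real.two_pi_pos.le
  -- only the values of `v` on `[0, 2π]` matter, so `v` is replaced by a continuous extension
  let w : C(ℝ, Pos d) := ⟨IccExtend h0 ((Icc 0 (2 * Real.pi)).domRestrict v),
    (continuousOn_iff_continuous_domRestrict.1 hv.continuousOn).Icc_extend'⟩
  have hw : ∀ θ ∈ Icc 0 (2 * Real.pi), w θ = v θ := fun θ hθ =>
    IccExtend_of_mem h0 ((Icc 0 (2 * Real.pi)).domRestrict v) hθ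
  have hwclosed : ∫ θ in (0 : ℝ)..(2 * Real.pi), w θ = 0 := by
    rw [← hclosed]
    refine intervalIntegral.integral_congr fun θ hθ => ?_
    rw [uIcc_of_le h0] at hθ
    exact hw θ hθ
  have hact : ∀ x ψ, act (holonomy A v x) ψ = (A.toConnection hA).wilson w x ψ := by
    intro x ψ
    rw [A.toEuclideanCLM_holonomy hA w hw x]
    exact congrArg (fun T : Col n →L[ℂ] Col n => T ψ)
      ((Matrix.toEuclideanCLM (𝕜 := ℂ)).apply_symm_apply ((A.toConnection hA).wilson w x))
  simp only [A.dirCovDeriv_eq hA, hact]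
  refine ⟨fun x => ?_, fun c f hf => (A.toConnection hA).existsUnique_isExpOrbit c hf,
    fun f hf => ?_, ?_⟩
  · rw [A.toEuclideanCLM_holonomy hA w hw x]
    exact A.tendsto_orderedProd_holonomyFactor hA w hw x
  · refine ((A.toConnection hA).tendsto_orderedProd_expDom w hwclosed hf).congr fun P => ?_
    rw [P.orderedProd_congr fun θ hθ h => by rw [hw θ hθ]]
  · rintro ⟨K, hK⟩
    obtain ⟨κ, hκ⟩ := A.hermBound_toConnection hA hK
    refine ⟨fun c => (A.toConnection hA).existsUnique_isExpGroup hκ c, ?_⟩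
    obtain ⟨T, hT, hT'⟩ :=
      (A.toConnection hA).exists_tendsto_orderedProd_expHilb hκ w hwclosed
    refine ⟨T, fun ψ => (hT ψ).congr fun P => ?_, hT'⟩
    rw [P.orderedProd_congr fun θ hθ h => by rw [hw θ hθ]]
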